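/- Setting. Let $d\ge 1$, $L>0$, $N\geq 2$ an even integer, $\mathbf j_*\in\mathbb Z^d\setminus\{0\}$ and $\phi_{\mathbf j_*}>0$. Put $k_{\mathbf j}=\frac{2\pi}{L}\mathbf j$ for $\mathbf j\in\mathbb Z^d$, let $a_{\mathbf j},a_{\mathbf j}^*$ be the bosonic annihilation and creation operators of the modes, and let $\mathcal F^N$ be the $N$-particle subspace of the bosonic Fock space. On $\mathcal F^N$ let $$W=\phi_{\mathbf j_*}\frac{a_{0}^*a_{0}^*a_{\mathbf j_*}a_{-\mathbf j_*}}{N},\qquad W^*=\phi_{\mathbf j_*}\frac{a_{0}a_{0}a^*_{\mathbf j_*}a^*_{-\mathbf j_*}}{N},$$ $$H=\sum_{\mathbf j\ne\pm\mathbf j_*}k_{\mathbf j}^2a^*_{\mathbf j}a_{\mathbf j}+\Big(k_{\mathbf j_*}^2+\phi_{\mathbf j_*}\frac{a_0^*a_0}{N}\Big)\big(a^*_{\mathbf j_*}a_{\mathbf j_*}+a^*_{-\mathbf j_*}a_{-\mathbf j_*}\big)+W+W^*,$$ and let $$\epsilon=\frac{k_{\mathbf j_*}^2}{\phi_{\mathbf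 j_*}},\qquad E^{Bog}=-\Big[k_{\mathbf j_*}^2+\phi_{\mathbf j_*}-\sqrt{(k_{\mathbf j_*}^2)^2+2\phi_{\mathbf j_*}k_{\mathbf j_*}^2}\Big].$$ For even $i$ with $0\le i\le N-2$ let $Q^{(i,i+1)}$ and $Q^{(>i+1)}$ be the orthogonal projections of $\mathcal F^N$ onto the vectors with $N-i$ or $N-i-1$ particles, respectively with fewer than $N-i-1$ particles, in the modes $\pm\mathbf j_*$. For real $z$ put $$R_{i,i}(z)=Q^{(i,i+1)}\frac{1}{Q^{(i,i+1)}(H-z)Q^{(i,i+1)}}Q^{(i,i+1)},\quad W_{i,i'}=Q^{(i,i+1)}WQ^{(i',i'+1)},\quad W^*_{i,i'}=Q^{(i,i+1)}W^*Q^{(i',i'+1)}.$$ The Feshbach–Schur Hamiltonians are defined by $K^{(-2)}(z)=H-z$ and, with $P=Q^{(>i+1)}$, $\overline P=Q^{(i,i+1)}$, $K=K^{(i-2)}(z)$, $$K^{(i)}(z)=PKP-PK\overline P\,\frac{1}{\overline PK\overline P}\,\overline PKP .$$ The effective interactions are $\Gamma_{2,2}(z)=W_{2,0}R_{0,0}(z)W^*_{0,2}$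 and, for even $4\le i\le N-2$, $$\Gamma_{i,i}(z)=W_{i,i-2}R_{i-2,i-2}(z)\sum_{l=0}^\infty\big[\Gamma_{i-2,i-2}(z)R_{i-2,i-2}(z)\big]^{l}\,W^*_{i-2,i}.$$ Put $\check\Gamma_{0,0}(z)=1$ and $\check\Gamma_{i,i}(z)=\sum_{l=0}^\infty\big[R_{i,i}(z)^{1/2}\Gamma_{i,i}(z)R_{i,i}(z)^{1/2}\big]^l$ for even $2\le i\le N-2$. Given a number $a_\epsilon$, define $X_0=1$ and $$X_{2j+2}=1-\frac{1}{4\Big(1+a_\epsilon-\frac{2b_\epsilon}{N-2j-1}-\frac{1-c_\epsilon}{(N-2j-1)^2}\Big)X_{2j}},$$ where, with $\delta=1+\sqrt\epsilon$ and $\chi_{[0,2)}$ the characteristic function of $[0,2)$, $b_\epsilon=(1+\epsilon)\,\delta\,\chi_{[0,2)}(\delta)\sqrt{\epsilon^2+2\epsilon}$ and $c_\epsilon=-(1-\delta^2\chi_{[0,2)}(\delta))(\epsilon^2+2\epsilon)$. Theorem. Let $\nu>\frac{11}{8}$. There are a function $a_\epsilon=2\epsilon+\mathcal O(\epsilon^\nu)$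 and a function $r(\epsilon)=o(1)$ (both as $\epsilon\to0^+$) and an $\epsilon_0>0$, all depending on $\nu$ only, such that the following holds for all $d,L,N,\mathbf j_*,\phi_{\mathbf j_*}$ as above with $\epsilon\le\epsilon_0$ and $\frac1N\le\epsilon^\nu$, and all real $$z\le E^{Bog}+\sqrt{\epsilon}\,\phi_{\mathbf j_*}\sqrt{\epsilon^2+2\epsilon}.$$ One has $z<0$, and for every even $i$ with $0\le i\le N-2$: 1. $Q^{(i,i+1)}(H-z)Q^{(i,i+1)}$ is bounded invertible on $Q^{(i,i+1)}\mathcal F^N$ and $R_{i,i}(z)\ge0$. 2. $K^{(i)}(z)$ is well defined, i.e. $Q^{(i,i+1)}K^{(i-2)}(z)Q^{(i,i+1)}$ is bounded invertible on $Q^{(i,i+1)}\mathcal F^N$; and $K^{(i)}(z)$ is self-adjoint on the domain of $Q^{(>i+1)}(H-z)Q^{(>i+1)}$. 3. For $i=0$, $$K^{(0)}(z)=Q^{(>1)}(H-z)Q^{(>1)}-Q^{(>1)}W\,R_{0,0}(z)\,W^*Q^{(>1)}.$$ For $i\ge2$ the series $\sum_l[\Gamma_{i,i}(z)R_{i,i}(z)]^l$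 and $\sum_l[R_{i,i}(z)^{1/2}\Gamma_{i,i}(z)R_{i,i}(z)^{1/2}]^l$ are summable in operator norm and $$K^{(i)}(z)=Q^{(>i+1)}(H-z)Q^{(>i+1)}-Q^{(>i+1)}W\,R_{i,i}(z)\sum_{l=0}^\infty\big[\Gamma_{i,i}(z)R_{i,i}(z)\big]^{l}\,W^*Q^{(>i+1)}.$$ 4. For $i\ge4$, $$\Gamma_{i,i}(z)=W_{i,i-2}R_{i-2,i-2}(z)^{1/2}\sum_{l=0}^\infty\big[R_{i-2,i-2}(z)^{1/2}\Gamma_{i-2,i-2}(z)R_{i-2,i-2}(z)^{1/2}\big]^{l}R_{i-2,i-2}(z)^{1/2}W^*_{i-2,i}.$$ 5. $X_i>0$, $\ \|\check\Gamma_{i,i}(z)\|\le 1/X_i$, and $X_i\ge\frac14+r(\epsilon)$; so $\|\check\Gamma_{i,i}(z)\|$ is bounded uniformly. -/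

import Mathlib

open Filter Topology Asymptotics
open scoped ENNReal NNReal

noncomputable section

namespace Bogoliubov

/-! ## Bosonic Fock space in the occupation number representation -/

/-- Labels `j ∈ ℤ^d` of the momentum modes `k_j = (2π/L) j`. -/
abbrev Mode (d : ℕ) := Fin d → ℤ

/-- Occupation numbers `(n_j)_j`, of finite total number. -/
abbrev Occ (d : ℕ) := Mode d →₀ ℕ

/-- Arbitrary families of coefficients with respect to the orthonormal basis of product states
`φ_n = ∏_j (n_j!)^{-1/2} (a_j^*)^{n_j} Ω`. The bosonic Fock space over `L²` of the periodic box is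
the space of square-summable amplitudes. -/
abbrev Amp (d : ℕ) := Occ d → ℂ

/-- The occupation numbers of states with exactly `N` particles. -/
abbrev Config (d N : ℕ) := {n : Occ d // n.degree = N}

/-- The `N`-particle space `𝓕^N`. -/
abbrev FockN (d N : ℕ) := lp (fun _ : Config d N => ℂ) 2

/-- Annihilation operator: `a_j φ_n = √(n_j) φ_{n - e_j}`, read on amplitudes. -/
def ann {d : ℕ} (j : Mode d) : Amp d →ₗ[ℂ] Amp d where
  toFun ψ := fun n => (Real.sqrt ((n j : ℝ) + 1) : ℂ) * ψ (n + Finsupp.single j 1)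
  map_add' ψ χ := by funext n; simp [mul_add]
  map_smul' c ψ := by funext n; simp; ring

/-- Creation operator: `a_j^* φ_n = √(n_j + 1) φ_{n + e_j}`, read on amplitudes
(the factor vanishes when `n_j = 0`, the only case in which the subtraction is truncated). -/
def cre {d : ℕ} (j : Mode d) : Amp d →ₗ[ℂ] Amp d where
  toFun ψ := fun n => (Real.sqrt (n j : ℝ) : ℂ) * ψ (n - Finsupp.single j 1)
  map_add' ψ χ := by funext n; simp [mul_add]
  map_smul' c ψ := by funext n; simp; ring

/-- Extension by zero of an `N`-particle coefficient family to all occupation numbers. -/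
def extend (d N : ℕ) : (Config d N → ℂ) →ₗ[ℂ] Amp d where
  toFun ψ := fun n => if h : n.degree = N then ψ ⟨n, h⟩ else 0
  map_add' ψ χ := by funext n; by_cases h : n.degree = N <;> simp [h]
  map_smul' c ψ := by funext n; by_cases h : n.degree = N <;> simp [h]

/-- The action of an operator on amplitudes, restricted to the `N`-particle sector. -/
def sectorMap {d : ℕ} (N : ℕ) (T : Amp d →ₗ[ℂ] Amp d) :
    (Config d N → ℂ) →ₗ[ℂ] (Config d N → ℂ) where
  toFun ψ := fun n => T (extend d N ψ) n.1
  map_add' ψ χ := by funext n; simp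
  map_smul' c ψ := by funext n; simp

/-- The operator on `𝓕^N` given by an operator on amplitudes, on its maximal domain
`{ψ ∈ 𝓕^N | T ψ ∈ 𝓕^N}`. -/
def sectorOp {d : ℕ} (N : ℕ) (T : Amp d →ₗ[ℂ] Amp d) : FockN d N →ₗ.[ℂ] FockN d N where
  domain :=
    { carrier := {ψ | Memℓp (sectorMap N T ψ) 2}
      add_mem' := by
        intro ψ χ hψ hχ
        have h := Memℓp.add hψ hχ
        simpa only [Set.mem_ofPred_eq, lp.coeFn_add, map_add] using h
      zero_mem' := by
        have h : sectorMap N T ((0 : FockN d N) : Config d N → ℂ) = 0 := by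
          rw [lp.coeFn_zero, map_zero]
        simp only [Set.mem_ofPred_eq, h]
        exact zero_memℓp
      smul_mem' := by
        intro c ψ hψ
        have h := Memℓp.const_smul hψ c
        simpa only [Set.mem_ofPred_eq, lp.coeFn_smul, map_smul] using h }
  toFun :=
    { toFun := fun ψ => (⟨sectorMap N T ψ.1, ψ.2⟩ : FockN d N)
      map_add' := by
        intro ψ χ
        apply Subtype.ext
        change sectorMap N T ((ψ.1 + χ.1 : FockN d N) : Config d N → ℂ) = _
        rw [lp.coeFn_add, map_add]
        rfl
      map_smul' := by
        intro c ψ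
        apply Subtype.ext
        change sectorMap N T ((c • ψ.1 : FockN d N) : Config d N → ℂ) = _
        rw [lp.coeFn_smul, map_smul]
        rfl }

/-! ### Boundedness on the `N`-particle sector -/

/-- `T` is bounded, with square-norm constant `C`, on amplitudes supported on `M` particles. -/
def SectorBound {d : ℕ} (M : ℕ) (C : ℝ≥0∞) (T : Amp d →ₗ[ℂ] Amp d) : Prop :=
  ∀ ψ : Amp d, (∀ n, ψ n ≠ 0 → n.degree = M) →
    ∑' n, ‖T ψ n‖ₑ ^ 2 ≤ C * ∑' n, ‖ψ n‖ₑ ^ 2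

/-- `T` maps amplitudes supported on `M` particles to amplitudes supported on `M'` particles. -/
def SectorShift {d : ℕ} (M M' : ℕ) (T : Amp d →ₗ[ℂ] Amp d) : Prop :=
  ∀ ψ : Amp d, (∀ n, ψ n ≠ 0 → n.degree = M) → ∀ n, T ψ n ≠ 0 → n.degree = M'

theorem SectorBound.comp {d M M' : ℕ} {C C' : ℝ≥0∞} {S T : Amp d →ₗ[ℂ] Amp d}
    (hS : SectorBound M' C' S) (hT : SectorBound M C T) (hT' : SectorShift M M' T) :
    SectorBound M (C' * C) (S ∘ₗ T) := by
  intro ψ hψ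
  calc ∑' n, ‖(S ∘ₗ T) ψ n‖ₑ ^ 2 ≤ C' * ∑' n, ‖T ψ n‖ₑ ^ 2 := hS (T ψ) (hT' ψ hψ)
    _ ≤ C' * (C * ∑' n, ‖ψ n‖ₑ ^ 2) := by gcongr; exact hT ψ hψ
    _ = _ := by rw [mul_assoc]

theorem SectorShift.comp {d M M' M'' : ℕ} {S T : Amp d →ₗ[ℂ] Amp d}
    (hS : SectorShift M' M'' S) (hT : SectorShift M M' T) : SectorShift M M'' (S ∘ₗ T) :=
  fun ψ hψ => hS (T ψ) (hT ψ hψ)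

theorem ann_shift {d : ℕ} (M : ℕ) (j : Mode d) : SectorShift M (M - 1) (ann j) := by
  intro ψ hψ n hn
  have h : ψ (n + Finsupp.single j 1) ≠ 0 := right_ne_zero_of_mul hn
  have := hψ _ h
  simp at this
  omega

theorem tsub_single_add_single {d : ℕ} {n : Occ d} {j : Mode d} (h : n j ≠ 0) :
    (n - Finsupp.single j 1) + Finsupp.single j 1 = n :=
  tsub_add_cancel_of_le (by simpa using Nat.one_le_iff_ne_zero.mpr h)

theorem cre_shift {d : ℕ} (M : ℕ) (j : Mode d) : SectorShift M (M + 1) (cre j) := by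
  intro ψ hψ n hn
  have h1 : n j ≠ 0 := by
    intro h0
    apply hn
    simp [cre, h0]
  have h2 : ψ (n - Finsupp.single j 1) ≠ 0 := right_ne_zero_of_mul hn
  have h3 := hψ _ h2
  rw [← tsub_single_add_single h1]
  simp [h3]

theorem enorm_sqrt_sq (x : ℝ) (hx : 0 ≤ x) : ‖((Real.sqrt x : ℝ) : ℂ)‖ₑ ^ 2 = ENNReal.ofReal x := by
  rw [← ofReal_norm, ← ENNReal.ofReal_pow (norm_nonneg _)]
  simp [Real.sq_sqrt hx]

theorem ann_bound {d : ℕ} (M : ℕ) (j : Mode d) : SectorBound M (M : ℝ≥0∞) (ann j) := by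
  intro ψ hψ
  have hinj : Function.Injective (fun n : Occ d => n + Finsupp.single j 1) :=
    fun a b h => by simpa using h
  calc ∑' n, ‖ann j ψ n‖ₑ ^ 2
      ≤ ∑' n, (M : ℝ≥0∞) * ‖ψ (n + Finsupp.single j 1)‖ₑ ^ 2 := by
        refine ENNReal.tsum_le_tsum fun n => ?_
        by_cases h : ψ (n + Finsupp.single j 1) = 0
        · simp [ann, h]
        · have h1 := hψ _ h
          have h2 : (n + Finsupp.single j 1 : Occ d) j ≤ M := by
            rw [← h1]; exact Finsupp.le_degree j _
          change ‖(Real.sqrt ((n j : ℝ) + 1) : ℂ) * ψ (n + Finsupp.single j 1)‖ₑ ^ 2 ≤ _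
          rw [enorm_mul, mul_pow, enorm_sqrt_sq _ (by positivity)]
          gcongr
          rw [← ENNReal.ofReal_natCast]
          apply ENNReal.ofReal_le_ofReal
          have h3 : n j + 1 ≤ M := by simpa using h2
          exact_mod_cast h3
    _ = (M : ℝ≥0∞) * ∑' n, ‖ψ (n + Finsupp.single j 1)‖ₑ ^ 2 := ENNReal.tsum_mul_left
    _ ≤ _ := by
        exact mul_le_mul_right
          (ENNReal.tsum_comp_le_tsum_of_injective hinj (fun n => ‖ψ n‖ₑ ^ 2)) _

theorem cre_bound {d : ℕ} (M : ℕ) (j : Mode d) :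
    SectorBound M ((M + 1 : ℕ) : ℝ≥0∞) (cre j) := by
  intro ψ hψ
  have hinj : Function.Injective (fun n : Occ d => n + Finsupp.single j 1) :=
    fun a b h => by simpa using h
  have hsupp : Function.support (fun n => ‖cre j ψ n‖ₑ ^ 2) ⊆
      Set.range (fun n : Occ d => n + Finsupp.single j 1) := by
    intro n hn
    have h1 : n j ≠ 0 := by
      intro h0
      apply hn
      simp [cre, h0]
    exact ⟨_, tsub_single_add_single h1⟩
  rw [← hinj.tsum_eq hsupp, ← ENNReal.tsum_mul_left]
  refine ENNReal.tsum_le_tsum fun n => ?_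
  by_cases h : ψ n = 0
  · simp [cre, h]
  · have h1 := hψ _ h
    have h2 : n j ≤ M := by rw [← h1]; exact Finsupp.le_degree j _
    have h3 : cre j ψ (n + Finsupp.single j 1) = (Real.sqrt ((n j : ℝ) + 1) : ℂ) * ψ n := by
      simp [cre]
    rw [h3, enorm_mul, mul_pow, enorm_sqrt_sq _ (by positivity)]
    gcongr
    rw [← ENNReal.ofReal_natCast]
    apply ENNReal.ofReal_le_ofReal
    exact_mod_cast Nat.succ_le_succ h2

theorem SectorBound.smul {d M : ℕ} {C : ℝ≥0∞} {T : Amp d →ₗ[ℂ] Amp d} (c : ℂ)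
    (hT : SectorBound M C T) : SectorBound M (‖c‖ₑ ^ 2 * C) (c • T) := by
  intro ψ hψ
  calc ∑' n, ‖(c • T) ψ n‖ₑ ^ 2 = ‖c‖ₑ ^ 2 * ∑' n, ‖T ψ n‖ₑ ^ 2 := by
        rw [← ENNReal.tsum_mul_left]
        refine tsum_congr fun n => ?_
        simp [enorm_mul, mul_pow]
    _ ≤ ‖c‖ₑ ^ 2 * (C * ∑' n, ‖ψ n‖ₑ ^ 2) := by gcongr; exact hT ψ hψ
    _ = _ := by rw [mul_assoc]

theorem SectorBound.exists_nnreal {d M : ℕ} {C : ℝ≥0∞} {T : Amp d →ₗ[ℂ] Amp d}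
    (hT : SectorBound M C T) (hC : C ≠ ∞) : ∃ C' : ℝ≥0, SectorBound M C' T :=
  ⟨C.toNNReal, by rwa [ENNReal.coe_toNNReal hC]⟩

theorem tsum_extend {d N : ℕ} (ψ : Config d N → ℂ) :
    ∑' n, ‖extend d N ψ n‖ₑ ^ 2 = ∑' n, ‖ψ n‖ₑ ^ 2 := by
  have hsupp : Function.support (fun n => ‖extend d N ψ n‖ₑ ^ 2) ⊆
      Set.range (Subtype.val : Config d N → Occ d) := by
    intro n hn
    by_cases h : n.degree = N
    · exact ⟨⟨n, h⟩, rfl⟩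
    · exact absurd (by simp [extend, h]) hn
  rw [← Subtype.val_injective.tsum_eq hsupp]
  refine tsum_congr fun n => ?_
  simp [extend, n.2]

theorem enorm_tsum_lp {d N : ℕ} (ψ : FockN d N) : ∑' n, ‖ψ n‖ₑ ^ 2 = ENNReal.ofReal (‖ψ‖ ^ 2) := by
  have h := lp.norm_rpow_eq_tsum (p := 2) (by simp) ψ
  have hs := (lp.memℓp ψ).summable (by simp)
  simp only [ENNReal.toReal_ofNat, Real.rpow_ofNat] at h hs
  rw [h, ENNReal.ofReal_tsum_of_nonneg (fun n => by positivity) hs]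
  refine tsum_congr fun n => ?_
  rw [← ofReal_norm, ENNReal.ofReal_pow (norm_nonneg _)]

theorem sector_tsum_le {d N : ℕ} {C : ℝ≥0} {T : Amp d →ₗ[ℂ] Amp d} (hT : SectorBound N C T)
    (ψ : FockN d N) :
    ∑' n, ‖sectorMap N T ψ n‖ₑ ^ 2 ≤ ENNReal.ofReal (C * ‖ψ‖ ^ 2) := by
  calc ∑' n, ‖sectorMap N T ψ n‖ₑ ^ 2
      ≤ ∑' n, ‖T (extend d N ψ) n‖ₑ ^ 2 :=
        ENNReal.tsum_comp_le_tsum_of_injective Subtype.val_injective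
          (fun n => ‖T (extend d N ψ) n‖ₑ ^ 2)
    _ ≤ C * ∑' n, ‖extend d N ψ n‖ₑ ^ 2 := by
        refine hT _ fun n hn => ?_
        by_contra h
        exact hn (by simp [extend, h])
    _ = _ := by
        rw [tsum_extend, enorm_tsum_lp, ENNReal.ofReal_mul (by positivity), ENNReal.ofReal_coe_nnreal]

theorem sector_memℓp {d N : ℕ} {C : ℝ≥0} {T : Amp d →ₗ[ℂ] Amp d} (hT : SectorBound N C T)
    (ψ : FockN d N) : Memℓp (sectorMap N T ψ) 2 := by
  apply memℓp_gen
  have h := ne_top_of_le_ne_top ENNReal.ofReal_ne_top (sector_tsum_le hT ψ)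
  simp only [ENNReal.toReal_ofNat, Real.rpow_ofNat]
  have h2 := ENNReal.summable_toReal h
  simpa using h2

/-- The bounded operator on `𝓕^N` given by an operator on amplitudes. -/
def sectorCLM {d : ℕ} (N : ℕ) (T : Amp d →ₗ[ℂ] Amp d) (hT : ∃ C : ℝ≥0, SectorBound N C T) :
    FockN d N →L[ℂ] FockN d N :=
  LinearMap.mkContinuousOfExistsBound
    { toFun := fun ψ => (⟨sectorMap N T ψ, sector_memℓp hT.choose_spec ψ⟩ : FockN d N)
      map_add' := by
        intro ψ χ
        apply Subtype.ext
        change sectorMap N T ((ψ + χ : FockN d N) : Config d N → ℂ) = _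
        rw [lp.coeFn_add, map_add]
        rfl
      map_smul' := by
        intro c ψ
        apply Subtype.ext
        change sectorMap N T ((c • ψ : FockN d N) : Config d N → ℂ) = _
        rw [lp.coeFn_smul, map_smul]
        rfl }
    (by
      obtain ⟨C, hC⟩ := hT
      refine ⟨Real.sqrt C, fun ψ => ?_⟩
      have h := sector_tsum_le hC ψ
      set χ : FockN d N := ⟨sectorMap N T ψ, sector_memℓp hC ψ⟩ with hχ
      change ‖χ‖ ≤ _
      have h2 : ENNReal.ofReal (‖χ‖ ^ 2) ≤ ENNReal.ofReal (C * ‖ψ‖ ^ 2) := by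
        rw [← enorm_tsum_lp]; exact h
      have h3 : ‖χ‖ ^ 2 ≤ C * ‖ψ‖ ^ 2 := (ENNReal.ofReal_le_ofReal_iff (by positivity)).1 h2
      apply le_of_sq_le_sq _ (by positivity)
      rw [mul_pow, Real.sq_sqrt (NNReal.coe_nonneg C)]
      exact h3)

/-! ## Operators with domains and the Feshbach–Schur map -/

section Feshbach

variable {E : Type*} [NormedAddCommGroup E] [NormedSpace ℂ E]

/-- A bounded operator as an everywhere defined operator. -/
def toP (A : E →L[ℂ] E) : E →ₗ.[ℂ] E := (A : E →ₗ[ℂ] E).toPMap ⊤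

/-- The product `A B`, on its natural domain `{ψ ∈ D(B) | B ψ ∈ D(A)}`. -/
def prodP (A B : E →ₗ.[ℂ] E) : E →ₗ.[ℂ] E where
  domain := (A.domain.comap B.toFun).map B.domain.subtype
  toFun :=
    { toFun := fun ψ => A ⟨B ⟨ψ.1, by
          obtain ⟨_, ⟨y, _, rfl⟩⟩ := ψ; exact y.2⟩, by
          obtain ⟨_, ⟨y, hy, rfl⟩⟩ := ψ; exact hy⟩
      map_add' := by
        intro ψ χ
        rw [← A.map_add]
        congr 1
        apply Subtype.ext
        simp only [Submodule.coe_add]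
        rw [← B.map_add]
        rfl
      map_smul' := by
        intro c ψ
        simp only [RingHom.id_apply]
        rw [← A.map_smul]
        congr 1
        apply Subtype.ext
        simp only [Submodule.coe_smul]
        rw [← B.map_smul]
        rfl }

/-- The sandwiched operator `P K P`. -/
def sandwich (P : E →L[ℂ] E) (K : E →ₗ.[ℂ] E) : E →ₗ.[ℂ] E :=
  prodP (toP P) (prodP K (toP P))

/-- For a projection `Q`, the bounded operator `R = Q (Q K Q)⁻¹ Q`: it lives on `Q E`, and there it
is the two-sided inverse of `Q K Q : Q E ∩ D(K) → Q E`. -/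
structure IsBlockInverse (Q : E →L[ℂ] E) (K : E →ₗ.[ℂ] E) (R : E →L[ℂ] E) : Prop where
  block : Q * R * Q = R
  right_inv : ∀ ψ : E, ∃ h : R ψ ∈ K.domain, Q (K ⟨R ψ, h⟩) = Q ψ
  left_inv : ∀ ψ : K.domain, Q ψ = ψ → R (K ψ) = ψ

/-- `Q K Q` is bounded invertible on `Q E`. -/
def BlockInvertible (Q : E →L[ℂ] E) (K : E →ₗ.[ℂ] E) : Prop :=
  ∃ R : E →L[ℂ] E, IsBlockInverse Q K R

theorem IsBlockInverse.unique {Q : E →L[ℂ] E} {K : E →ₗ.[ℂ] E} {R R' : E →L[ℂ] E}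
    (hQ : Q * Q = Q) (h : IsBlockInverse Q K R) (h' : IsBlockInverse Q K R') : R = R' := by
  ext ψ
  obtain ⟨hd, he⟩ := h.right_inv ψ
  have hq : ∀ {S : E →L[ℂ] E}, IsBlockInverse Q K S → ∀ χ, S (Q χ) = S χ := by
    intro S hS χ
    have h1 : S * Q = S := by
      rw [← hS.block]
      simp only [mul_assoc, hQ]
    exact congrArg (fun T : E →L[ℂ] E => T χ) h1
  have hQR : Q (R ψ) = R ψ := by
    have h1 : Q * R = R := by
      rw [← h.block]
      simp only [← mul_assoc, hQ]
    exact congrArg (fun T : E →L[ℂ] E => T ψ) h1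
  have h2 := h'.left_inv ⟨R ψ, hd⟩ hQR
  rw [← hq h', he, hq h'] at h2
  exact h2.symm

open Classical in
/-- `Q (Q K Q)⁻¹ Q` (and `0` if `Q K Q` is not bounded invertible on `Q E`). -/
def blockInv (Q : E →L[ℂ] E) (K : E →ₗ.[ℂ] E) : E →L[ℂ] E :=
  if h : BlockInvertible Q K then h.choose else 0

/-- The Feshbach–Schur map for the projections `P`, `Q`:
`P K P - P K Q (Q K Q)⁻¹ Q K P`. An operator on `P E` is extended by `0` to the rest of `E`. -/
def feshbach (P Q : E →L[ℂ] E) (K : E →ₗ.[ℂ] E) : E →ₗ.[ℂ] E :=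
  sandwich P K -
    prodP (toP P) (prodP K (prodP (toP Q) (prodP (toP (blockInv Q K))
      (prodP (toP Q) (prodP K (toP P))))))

end Feshbach

/-- The nonnegative square root of a nonnegative bounded operator on a Hilbert space. -/
def opSqrt {E : Type*} [NormedAddCommGroup E] [InnerProductSpace ℂ E] [CompleteSpace E]
    (A : E →L[ℂ] E) : E →L[ℂ] E := CFC.sqrt A

/-! ## The three-modes Bogoliubov Hamiltonian -/

/-- The data of the three-modes system: `N` (even) particles in a `d`-dimensional box of side `L`
with periodic boundary conditions, and a pair potential whose Fourier component at the nonzero modes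
`±j` is `phi > 0`. -/
structure ThreeModes (d : ℕ) where
  L : ℝ
  L_pos : 0 < L
  N : ℕ
  N_even : Even N
  j : Mode d
  j_ne_zero : j ≠ 0
  phi : ℝ
  phi_pos : 0 < phi

namespace ThreeModes

variable {d : ℕ} (S : ThreeModes d)

/-- `k_l² = |(2π/L) l|²`. -/
def ksq (l : Mode d) : ℝ := ∑ r, (2 * Real.pi / S.L * (l r : ℝ)) ^ 2

/-- The ratio `ε = k_{j}² / φ_{j}`. -/
def eps : ℝ := S.ksq S.j / S.phi

/-- The Bogoliubov energy `E^{Bog}_{j}`. -/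
def EBog : ℝ :=
  -(S.ksq S.j + S.phi - Real.sqrt ((S.ksq S.j) ^ 2 + 2 * S.phi * S.ksq S.j))

/-- `W = φ a_0^* a_0^* a_j a_{-j} / N` on amplitudes. -/
def WAmp : Amp d →ₗ[ℂ] Amp d :=
  ((S.phi / S.N : ℝ) : ℂ) • (cre 0 ∘ₗ cre 0 ∘ₗ ann S.j ∘ₗ ann (-S.j))

/-- `W^* = φ a_0 a_0 a_j^* a_{-j}^* / N` on amplitudes. -/
def WstarAmp : Amp d →ₗ[ℂ] Amp d :=
  ((S.phi / S.N : ℝ) : ℂ) • (ann 0 ∘ₗ ann 0 ∘ₗ cre S.j ∘ₗ cre (-S.j))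

/-- `(k_j² + φ a_0^* a_0 / N) (a_j^* a_j + a_{-j}^* a_{-j})` on amplitudes. -/
def H0Amp : Amp d →ₗ[ℂ] Amp d :=
  (((S.ksq S.j : ℝ) : ℂ) • LinearMap.id + ((S.phi / S.N : ℝ) : ℂ) • (cre 0 ∘ₗ ann 0)) ∘ₗ
    (cre S.j ∘ₗ ann S.j + cre (-S.j) ∘ₗ ann (-S.j))

/-- The kinetic energy `∑_{l ≠ ±j} k_l² a_l^* a_l` of the other modes on amplitudes; at the
occupation numbers `n` only the modes `l` with `n_l ≠ 0` contribute. -/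
def kinAmp : Amp d →ₗ[ℂ] Amp d where
  toFun ψ := fun n =>
    ∑ l ∈ n.support with l ≠ S.j ∧ l ≠ -S.j, ((S.ksq l : ℝ) : ℂ) * cre l (ann l ψ) n
  map_add' ψ χ := by funext n; simp [mul_add, Finset.sum_add_distrib]
  map_smul' c ψ := by
    funext n
    simp only [map_smul, Pi.smul_apply, smul_eq_mul, RingHom.id_apply, Finset.mul_sum]
    exact Finset.sum_congr rfl fun l _ => by ring

/-- The Hamiltonian `H^{Bog}_{j}` on `𝓕^N`. -/
def HBog : FockN d S.N →ₗ.[ℂ] FockN d S.N :=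
  sectorOp S.N (S.kinAmp + (S.H0Amp + S.WAmp + S.WstarAmp))

theorem WAmp_bound : ∃ C : ℝ≥0, SectorBound S.N C S.WAmp := by
  have h := ((cre_bound _ 0).comp ((cre_bound _ 0).comp ((ann_bound _ S.j).comp
    (ann_bound S.N (-S.j)) (ann_shift _ _)) ((ann_shift _ _).comp (ann_shift _ _)))
    ((cre_shift _ _).comp ((ann_shift _ _).comp (ann_shift _ _)))).smul
    (((S.phi / S.N : ℝ) : ℂ))
  exact h.exists_nnreal (by finiteness)

theorem WstarAmp_bound : ∃ C : ℝ≥0, SectorBound S.N C S.WstarAmp := by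
  have h := ((ann_bound _ 0).comp ((ann_bound _ 0).comp ((cre_bound _ S.j).comp
    (cre_bound S.N (-S.j)) (cre_shift _ _)) ((cre_shift _ _).comp (cre_shift _ _)))
    ((ann_shift _ _).comp ((cre_shift _ _).comp (cre_shift _ _)))).smul
    (((S.phi / S.N : ℝ) : ℂ))
  exact h.exists_nnreal (by finiteness)

/-- The bounded operator `W` on `𝓕^N`. -/
def W : FockN d S.N →L[ℂ] FockN d S.N := sectorCLM S.N S.WAmp S.WAmp_bound

/-- The bounded operator `W^*` on `𝓕^N`. -/
def Wstar : FockN d S.N →L[ℂ] FockN d S.N := sectorCLM S.N S.WstarAmp S.WstarAmp_bound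

/-! ## Feshbach–Schur flow -/

open Classical in
/-- Orthogonal projection onto the closed span of the product states `φ_n`, `n ∈ A`. -/
def proj (A : Set (Occ d)) : FockN d S.N →L[ℂ] FockN d S.N :=
  sectorCLM S.N
    { toFun := fun ψ n => if n ∈ A then ψ n else 0
      map_add' := by intro ψ χ; funext n; by_cases h : n ∈ A <;> simp [h]
      map_smul' := by intro c ψ; funext n; by_cases h : n ∈ A <;> simp [h] }
    ⟨1, by
      intro ψ _
      simp only [ENNReal.coe_one, one_mul]
      refine ENNReal.tsum_le_tsum fun n => ?_
      by_cases h : n ∈ A <;> simp [h]⟩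

/-- `Q^{(i,i+1)}`: the number of particles in the modes `±j` is `N - i` or `N - i - 1`. -/
def Q (i : ℕ) : FockN d S.N →L[ℂ] FockN d S.N :=
  S.proj {n | n S.j + n (-S.j) + i = S.N ∨ n S.j + n (-S.j) + (i + 1) = S.N}

/-- `Q^{(>i+1)}`: the number of particles in the modes `±j` is less than `N - i - 1`. -/
def QGt (i : ℕ) : FockN d S.N →L[ℂ] FockN d S.N :=
  S.proj {n | n S.j + n (-S.j) + (i + 1) < S.N}

/-- `H^{Bog}_{j} - z`. -/
def HSub (z : ℝ) : FockN d S.N →ₗ.[ℂ] FockN d S.N := S.HBog - toP ((z : ℂ) • 1)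

/-- The operator to which the Feshbach–Schur map of step `i = 2 s` is applied (`K^{(i-2)}(z)`, where
`K^{(-2)}(z) = H^{Bog}_{j} - z`). -/
def KPrev (z : ℝ) : ℕ → (FockN d S.N →ₗ.[ℂ] FockN d S.N)
  | 0 => S.HSub z
  | s + 1 => feshbach (S.QGt (2 * s)) (S.Q (2 * s)) (KPrev z s)

/-- The Feshbach–Schur Hamiltonian `K^{Bog,(i)}_{j}(z)`, `i = 2 s`. -/
def K (z : ℝ) (s : ℕ) : FockN d S.N →ₗ.[ℂ] FockN d S.N :=
  feshbach (S.QGt (2 * s)) (S.Q (2 * s)) (S.KPrev z s)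

/-- `R_{i,i}(z) = Q^{(i,i+1)} (Q^{(i,i+1)} (H - z) Q^{(i,i+1)})⁻¹ Q^{(i,i+1)}`. -/
def R (z : ℝ) (i : ℕ) : FockN d S.N →L[ℂ] FockN d S.N := blockInv (S.Q i) (S.HSub z)

/-- `R_{i,i}(z)^{1/2}`. -/
def Rsqrt (z : ℝ) (i : ℕ) : FockN d S.N →L[ℂ] FockN d S.N := opSqrt (S.R z i)

/-- `W_{i,i'} = Q^{(i,i+1)} W Q^{(i',i'+1)}`. -/
def Wblock (i i' : ℕ) : FockN d S.N →L[ℂ] FockN d S.N := S.Q i * S.W * S.Q i'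

/-- `W^*_{i,i'} = Q^{(i,i+1)} W^* Q^{(i',i'+1)}`. -/
def Wstarblock (i i' : ℕ) : FockN d S.N →L[ℂ] FockN d S.N := S.Q i * S.Wstar * S.Q i'

/-- The effective interaction `Γ_{i,i}(z)`, `i = 2 s`, for `i ≥ 2` (set to `0` for `i = 0`, where it
is not used). -/
def Gam (z : ℝ) : ℕ → (FockN d S.N →L[ℂ] FockN d S.N)
  | 0 => 0
  | 1 => S.Wblock 2 0 * S.R z 0 * S.Wstarblock 0 2
  | s + 2 =>
      S.Wblock (2 * (s + 2)) (2 * (s + 1)) * S.R z (2 * (s + 1)) *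
        (∑' l : ℕ, (Gam z (s + 1) * S.R z (2 * (s + 1))) ^ l) *
        S.Wstarblock (2 * (s + 1)) (2 * (s + 2))

/-- `R_{i,i}^{1/2} Γ_{i,i} R_{i,i}^{1/2}`, `i = 2 s`. -/
def GamSym (z : ℝ) (s : ℕ) : FockN d S.N →L[ℂ] FockN d S.N :=
  S.Rsqrt z (2 * s) * S.Gam z s * S.Rsqrt z (2 * s)

/-- `Γ̌_{i,i}(z)`, `i = 2 s`: the sum `∑_l (R^{1/2} Γ R^{1/2})^l` for `i ≥ 2`, and `1` for `i = 0`. -/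
def GamCheck (z : ℝ) : ℕ → (FockN d S.N →L[ℂ] FockN d S.N)
  | 0 => 1
  | s + 1 => ∑' l : ℕ, (S.GamSym z (s + 1)) ^ l

end ThreeModes

/-! ## The auxiliary sequence -/

/-- Characteristic function of `[0,2)`. -/
def chi (δ : ℝ) : ℝ := Set.indicator (Set.Ico (0 : ℝ) 2) 1 δ

/-- `b_ε`, with `δ = 1 + √ε`. -/
def bSeq (ε : ℝ) : ℝ :=
  (1 + ε) * (1 + Real.sqrt ε) * chi (1 + Real.sqrt ε) * Real.sqrt (ε ^ 2 + 2 * ε)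

/-- `c_ε`, with `δ = 1 + √ε`. -/
def cSeq (ε : ℝ) : ℝ :=
  -(1 - (1 + Real.sqrt ε) ^ 2 * chi (1 + Real.sqrt ε)) * (ε ^ 2 + 2 * ε)

/-- `XSeq a ε N s` is `X_{2 s}` for the parameters `a_ε = a`, `b_ε`, `c_ε`. -/
def XSeq (a ε : ℝ) (N : ℕ) : ℕ → ℝ
  | 0 => 1
  | s + 1 =>
      1 - 1 / (4 * (1 + a - 2 * bSeq ε / ((N : ℝ) - 2 * s - 1)
        - (1 - cSeq ε) / ((N : ℝ) - 2 * s - 1) ^ 2) * XSeq a ε N s)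

end Bogoliubov

end

/-!
In the occupation-number basis every operator of the flow is either diagonal or a weighted shift:
`W` moves a pair of particles from the modes `±j` to the mode `0`, and `W^*` moves it back. Hence
`W A W^*` is diagonal whenever `A` is, and by induction every `Γ_{i,i} R_{i,i}` is diagonal. Its
entry at `n` is `t / (1 - y)`, where `y` is the entry for `i - 2` at the configuration with one more
pair in `±j`, and `t` is the square of the matrix element of `W` times two diagonal resolvents. The
Neumann series therefore reduce to a scalar continued fraction.

For `ε ≤ 10⁻⁸` and `a_ε = 2 ε` one has `t ≤ 1 / (4 A)` with `A` the bracket in the recursion of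
`X`, so the entries of `Γ_{i,i} R_{i,i}` are at most `1 - X_i < 1`. The lower bound on `X_i` comes
from a subsolution of its recursion of discrete Riccati type, `(1 + σ - τ / (N - i - q)) / 2` with
`τ = 1 + 2 √ε`, `σ = b_ε / τ` and `q = ε^{1/4}`.
-/

noncomputable section

namespace Bogoliubov

/-! ## Diagonal operators and weighted shifts -/

section Diagonal

variable {ι : Type*}

/-- The Hilbert space `ℓ²(ι)` of square-summable complex families. -/
abbrev Ltwo (ι : Type*) := lp (fun _ : ι => ℂ) 2

/-- `A` is diagonal in the standard basis of `ℓ²(ι)`, with real eigenvalues `f`. -/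
def IsDiag (A : Ltwo ι →L[ℂ] Ltwo ι) (f : ι → ℝ) : Prop :=
  ∀ (ψ : Ltwo ι) (n : ι), A ψ n = (f n : ℂ) * ψ n

namespace IsDiag

variable {A B : Ltwo ι →L[ℂ] Ltwo ι} {f g : ι → ℝ}

theorem eq (hA : IsDiag A f) (hB : IsDiag B f) : A = B := by
  ext ψ n
  rw [hA, hB]

theorem one : IsDiag (1 : Ltwo ι →L[ℂ] Ltwo ι) 1 := fun ψ n => by simp

theorem zero : IsDiag (0 : Ltwo ι →L[ℂ] Ltwo ι) 0 := fun ψ n => by simp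

theorem mul (hA : IsDiag A f) (hB : IsDiag B g) : IsDiag (A * B) (f * g) := fun ψ n => by
  rw [mul_apply_eq_comp, hA, hB, Pi.mul_apply, Complex.ofReal_mul, mul_assoc]

theorem sub (hA : IsDiag A f) (hB : IsDiag B g) : IsDiag (A - B) (f - g) := fun ψ n => by
  rw [sub_apply, lp.coeFn_sub, Pi.sub_apply, hA, hB, Pi.sub_apply,
    Complex.ofReal_sub, sub_mul]

theorem mul_eq {C : Ltwo ι →L[ℂ] Ltwo ι} {h : ι → ℝ} (hA : IsDiag A f) (hB : IsDiag B g)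
    (hC : IsDiag C h) (hfg : f * g = h) : A * B = C :=
  (hfg ▸ hA.mul hB).eq hC

theorem apply_single [DecidableEq ι] (hA : IsDiag A f) (n : ι) (c : ℂ) :
    A (lp.single 2 n c) = lp.single 2 n ((f n : ℂ) * c) := by
  ext m
  rw [hA]
  by_cases hm : m = n
  · subst hm; simp
  · simp [hm]

theorem abs_le_norm (hA : IsDiag A f) (n : ι) : |f n| ≤ ‖A‖ := by
  classical
  have h := A.le_opNorm (lp.single 2 n 1)
  simpa [hA.apply_single, lp.norm_single] using h

theorem norm_le (hA : IsDiag A f) {C : ℝ} (hC : 0 ≤ C) (h : ∀ n, |f n| ≤ C) : ‖A‖ ≤ C := by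
  have hT : ∀ n, ‖(f n : ℂ) • ContinuousLinearMap.id ℂ ℂ‖ ≤ C := fun n => by
    simpa [norm_smul] using h n
  have hA' : A = lp.mapCLM 2 (fun n => (f n : ℂ) • ContinuousLinearMap.id ℂ ℂ) hC hT := by
    ext ψ n
    simp [hA ψ n]
  exact hA' ▸ lp.norm_mapCLM_le 2 _ hC hT

theorem isSelfAdjoint (hA : IsDiag A f) : IsSelfAdjoint A := by
  rw [ContinuousLinearMap.isSelfAdjoint_iff_isSymmetric]
  intro ψ χ
  simp only [ContinuousLinearMap.coe_coe, lp.inner_eq_tsum]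
  refine tsum_congr fun n => ?_
  simp only [hA _ n, RCLike.inner_apply, map_mul, Complex.conj_ofReal]
  ring

end IsDiag

theorem exists_isDiag {f : ι → ℝ} {C : ℝ} (hC : 0 ≤ C) (h : ∀ n, |f n| ≤ C) :
    ∃ A : Ltwo ι →L[ℂ] Ltwo ι, IsDiag A f :=
  ⟨lp.mapCLM 2 (fun n => (f n : ℂ) • ContinuousLinearMap.id ℂ ℂ) hC fun n => by
    simpa [norm_smul] using h n, fun ψ n => by simp⟩

namespace IsDiag

variable {A : Ltwo ι →L[ℂ] Ltwo ι} {f : ι → ℝ}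

theorem exists_isDiag_sqrt (hA : IsDiag A f) (hf : 0 ≤ f) :
    ∃ B : Ltwo ι →L[ℂ] Ltwo ι, IsDiag B (fun n => √(f n)) ∧ B * B = A := by
  obtain ⟨B, hB⟩ := exists_isDiag (f := fun n => √(f n)) (Real.sqrt_nonneg ‖A‖) fun n => by
    rw [abs_of_nonneg (Real.sqrt_nonneg _)]
    exact Real.sqrt_le_sqrt ((le_abs_self _).trans (hA.abs_le_norm n))
  exact ⟨B, hB, hB.mul_eq hB hA <| funext fun n => Real.mul_self_sqrt (hf n)⟩

theorem nonneg (hA : IsDiag A f) (hf : 0 ≤ f) : 0 ≤ A := by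
  obtain ⟨B, hB, rfl⟩ := hA.exists_isDiag_sqrt hf
  exact hB.isSelfAdjoint.mul_self_nonneg

theorem opSqrt (hA : IsDiag A f) (hf : 0 ≤ f) : IsDiag (opSqrt A) (fun n => √(f n)) := by
  obtain ⟨B, hB, hBB⟩ := hA.exists_isDiag_sqrt hf
  have hAB : Bogoliubov.opSqrt A = B :=
    CFC.sqrt_unique hBB (hB.nonneg fun n => Real.sqrt_nonneg _)
  rwa [hAB]

theorem tsum_pow (hA : IsDiag A f) (h : ‖A‖ < 1) :
    IsDiag (∑' l : ℕ, A ^ l) (1 - f)⁻¹ := by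
  intro ψ n
  have hgeom := (one.sub hA) ((∑' l : ℕ, A ^ l) ψ) n
  rw [← mul_apply_eq_comp, mul_neg_geom_series A h] at hgeom
  have hne : (((1 - f) n : ℝ) : ℂ) ≠ 0 := by
    have := (le_abs_self _).trans (hA.abs_le_norm n)
    exact Complex.ofReal_ne_zero.2 (sub_ne_zero.2 (by rw [Pi.one_apply]; linarith))
  rw [Pi.inv_apply, Complex.ofReal_inv, eq_inv_mul_iff_mul_eq₀ hne]
  exact hgeom.symm

end IsDiag

/-- `A` is the weighted shift `(A ψ) n = a n • ψ (u n)` on `ℓ²(ι)`. -/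
def IsWeightedShift (A : Ltwo ι →L[ℂ] Ltwo ι) (a : ι → ℝ) (u : ι → ι) : Prop :=
  ∀ (ψ : Ltwo ι) (n : ι), A ψ n = (a n : ℂ) * ψ (u n)

namespace IsWeightedShift

variable {A B D D' : Ltwo ι →L[ℂ] Ltwo ι} {a b f f' : ι → ℝ} {u v : ι → ι}

theorem isDiag_mul_mul (hA : IsWeightedShift A a u) (hD : IsDiag D f)
    (hB : IsWeightedShift B b v) (h : ∀ n, a n ≠ 0 → v (u n) = n ∧ b (u n) = a n) :
    IsDiag (A * D * B) (fun n => a n ^ 2 * f (u n)) := by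
  intro ψ n
  rw [mul_apply_eq_comp, mul_apply_eq_comp, hA, hD, hB]
  rcases eq_or_ne (a n) 0 with ha | ha
  · simp [ha]
  · rw [(h n ha).1, (h n ha).2]
    push_cast
    ring

theorem mul_mul_eq_zero (hA : IsWeightedShift A a u) (hD : IsDiag D f) (hD' : IsDiag D' f')
    (h : ∀ n, a n ≠ 0 → f n * f' (u n) = 0) : D * A * D' = 0 := by
  ext ψ n
  rw [mul_apply_eq_comp, mul_apply_eq_comp, hD, hA, hD']
  have hn : f n * a n * f' (u n) = 0 := by
    rcases eq_or_ne (a n) 0 with ha | ha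
    · simp [ha]
    · linear_combination a n * h n ha
  rw [← mul_assoc, ← mul_assoc, ← Complex.ofReal_mul, ← Complex.ofReal_mul, hn]
  simp

theorem star_eq (hA : IsWeightedShift A a u) (hB : IsWeightedShift B b v)
    (h : ∀ n, a n ≠ 0 → v (u n) = n ∧ b (u n) = a n)
    (h' : ∀ n, b n ≠ 0 → u (v n) = n ∧ a (v n) = b n) : star A = B := by
  classical
  ext χ m
  have hsingle : A (lp.single 2 m 1) = lp.single 2 (v m) (b m : ℂ) := by
    ext n
    rw [hA, lp.coeFn_single, lp.coeFn_single, Pi.single_apply, Pi.single_apply]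
    by_cases hum : u n = m ∧ a n ≠ 0
    · obtain ⟨rfl, ha⟩ := hum
      simp [h n ha]
    · by_cases hvm : n = v m ∧ b m ≠ 0
      · obtain ⟨rfl, hb⟩ := hvm
        exact absurd ⟨(h' m hb).1, (h' m hb).2 ▸ hb⟩ hum
      · aesop
  have hinner := ContinuousLinearMap.adjoint_inner_right A (lp.single 2 m 1) χ
  rw [hsingle, lp.inner_single_left, lp.inner_single_left,
    ← ContinuousLinearMap.star_eq_adjoint] at hinner
  rw [hB]
  simpa [mul_comm] using hinner

end IsWeightedShift

end Diagonal

section Graph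

variable {R E F : Type*} [Ring R] [AddCommGroup E] [Module R E] [AddCommGroup F] [Module R F]

theorem mem_graph_iff_exists (A : E →ₗ.[R] F) {ψ : E} {χ : F} :
    (ψ, χ) ∈ A.graph ↔ ∃ h : ψ ∈ A.domain, A ⟨ψ, h⟩ = χ := by
  simp

theorem linearPMap_ext_graph {A B : E →ₗ.[R] F}
    (h : ∀ ψ χ, (ψ, χ) ∈ A.graph ↔ (ψ, χ) ∈ B.graph) : A = B :=
  LinearPMap.eq_of_eq_graph (Submodule.ext fun ⟨ψ, χ⟩ => h ψ χ)

theorem mem_graph_sub {A B : E →ₗ.[R] F} {ψ : E} {χ : F} :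
    (ψ, χ) ∈ (A - B).graph ↔ ∃ a b, (ψ, a) ∈ A.graph ∧ (ψ, b) ∈ B.graph ∧ a - b = χ := by
  simp only [mem_graph_iff_exists]
  constructor
  · rintro ⟨h, rfl⟩
    exact ⟨_, _, ⟨h.1, rfl⟩, ⟨h.2, rfl⟩, rfl⟩
  · rintro ⟨a, b, ⟨ha, rfl⟩, ⟨hb, rfl⟩, rfl⟩
    exact ⟨⟨ha, hb⟩, rfl⟩

end Graph

section Feshbach

variable {E : Type*} [NormedAddCommGroup E] [NormedSpace ℂ E]

theorem mem_graph_toP {A : E →L[ℂ] E} {ψ χ : E} : (ψ, χ) ∈ (toP A).graph ↔ A ψ = χ := by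
  rw [mem_graph_iff_exists]
  exact ⟨fun ⟨_, h⟩ => h, fun h => ⟨trivial, h⟩⟩

theorem mem_graph_prodP {A B : E →ₗ.[ℂ] E} {ψ χ : E} :
    (ψ, χ) ∈ (prodP A B).graph ↔ ∃ η, (ψ, η) ∈ B.graph ∧ (η, χ) ∈ A.graph := by
  simp only [mem_graph_iff_exists]
  constructor
  · rintro ⟨⟨y, hy, rfl⟩, rfl⟩
    exact ⟨_, ⟨y.2, rfl⟩, ⟨hy, rfl⟩⟩
  · rintro ⟨η, ⟨hψ, rfl⟩, ⟨hη, rfl⟩⟩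
    exact ⟨⟨⟨ψ, hψ⟩, hη, rfl⟩, rfl⟩

theorem mem_graph_sandwich {P : E →L[ℂ] E} {K : E →ₗ.[ℂ] E} {ψ χ : E} :
    (ψ, χ) ∈ (sandwich P K).graph ↔ ∃ ζ, (P ψ, ζ) ∈ K.graph ∧ P ζ = χ := by
  simp only [sandwich, mem_graph_prodP, mem_graph_toP, exists_eq_left']

theorem IsBlockInverse.blockInv_eq {Q : E →L[ℂ] E} {K : E →ₗ.[ℂ] E} {R : E →L[ℂ] E}
    (hQ : Q * Q = Q) (h : IsBlockInverse Q K R) : blockInv Q K = R := by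
  have hb : BlockInvertible Q K := ⟨R, h⟩
  rw [blockInv, dif_pos hb]
  exact hb.choose_spec.unique hQ h

end Feshbach

section PerturbedMul

variable {ι : Type*}

/-- The operator of multiplication by `f` on its maximal domain, plus the bounded operator `B`.
It is defined through its graph. -/
def perturbedMul (f : ι → ℝ) (B : Ltwo ι →L[ℂ] Ltwo ι) : Ltwo ι →ₗ.[ℂ] Ltwo ι :=
  Submodule.toLinearPMap
    { carrier := {x | ∀ n, x.2 n = (f n : ℂ) * x.1 n + B x.1 n}
      add_mem' := fun {x y} hx hy n => by
        simp only [Prod.fst_add, Prod.snd_add, map_add, lp.coeFn_add, Pi.add_apply, hx n, hy n]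
        ring
      zero_mem' := fun n => by simp
      smul_mem' := fun c x hx n => by
        simp only [Prod.smul_fst, Prod.smul_snd, map_smul, lp.coeFn_smul, Pi.smul_apply, hx n,
          smul_eq_mul]
        ring }

variable {f g : ι → ℝ} {A B C : Ltwo ι →L[ℂ] Ltwo ι} {ψ χ : Ltwo ι}

theorem mem_graph_perturbedMul :
    (ψ, χ) ∈ (perturbedMul f B).graph ↔ ∀ n, χ n = (f n : ℂ) * ψ n + B ψ n := by
  rw [perturbedMul, Submodule.toLinearPMap_graph_eq]
  · rfl
  · rintro ⟨_, χ⟩ hχ rfl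
    ext n
    simpa using hχ n

theorem perturbedMul_sub_toP : perturbedMul f B - toP C = perturbedMul f (B - C) := by
  refine linearPMap_ext_graph fun ψ χ => ?_
  simp only [mem_graph_sub, mem_graph_toP, mem_graph_perturbedMul]
  constructor
  · rintro ⟨a, _, ha, rfl, rfl⟩ n
    simp [ha, add_sub_assoc]
  · intro h
    refine ⟨χ + C ψ, _, fun n => ?_, rfl, by simp⟩
    simp [h, add_assoc]

theorem IsDiag.perturbedMul_sub (hC : IsDiag C g) :
    perturbedMul f (B - C) = perturbedMul (f - g) B := by
  refine linearPMap_ext_graph fun ψ χ => ?_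
  simp only [mem_graph_perturbedMul]
  refine forall_congr' fun n => ?_
  rw [sub_apply, lp.coeFn_sub, Pi.sub_apply, hC, Pi.sub_apply,
    Complex.ofReal_sub]
  ring_nf

theorem mem_graph_perturbedMul_zero : (ψ, χ) ∈ (perturbedMul 0 B).graph ↔ χ = B ψ := by
  rw [mem_graph_perturbedMul, lp.ext_iff, funext_iff]
  simp only [Pi.zero_apply, Complex.ofReal_zero, zero_mul, zero_add]

theorem IsDiag.mem_graph_compress {a c : ι → ℝ} (hA : IsDiag A a) (hC : IsDiag C c)
    (h : (C ψ, χ) ∈ (perturbedMul f B).graph) :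
    (ψ, A χ) ∈ (perturbedMul (a * f * c) (A * B * C)).graph := by
  rw [mem_graph_perturbedMul] at h ⊢
  intro n
  simp only [mul_apply_eq_comp]
  rw [hA, h, hC, hA, Pi.mul_apply, Pi.mul_apply]
  push_cast
  ring

theorem sandwich_perturbedMul {P : Ltwo ι →L[ℂ] Ltwo ι} {p : ι → ℝ} (hP : IsDiag P p)
    (hp : p * p = p) : sandwich P (perturbedMul f B) = perturbedMul (p * f) (P * B * P) := by
  have hpfp : p * f * p = p * f := by rw [mul_right_comm, hp]
  refine linearPMap_ext_graph fun ψ χ => ?_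
  rw [mem_graph_sandwich]
  constructor
  · rintro ⟨ζ, hζ, rfl⟩
    exact hpfp ▸ hP.mem_graph_compress hP hζ
  · intro h
    have hζ : (P ψ, χ - (P * B * P) ψ + B (P ψ)) ∈ (perturbedMul f B).graph := by
      rw [mem_graph_perturbedMul] at h ⊢
      intro n
      simp only [lp.coeFn_add, lp.coeFn_sub, Pi.add_apply, Pi.sub_apply, h, hP ψ, Pi.mul_apply]
      push_cast
      ring
    refine ⟨_, hζ, LinearPMap.mem_graph_snd_inj _ ?_ h rfl⟩
    exact hpfp ▸ hP.mem_graph_compress hP hζ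

section Block

variable {Q R : Ltwo ι →L[ℂ] Ltwo ι} {q ρ : ι → ℝ}

theorem isBlockInverse_perturbedMul (hQ : IsDiag Q q) (hq : q * q = q) (hB : Q * B * Q = 0)
    (hR : IsDiag R ρ) (hqρ : q * ρ = ρ) (hρ : ρ * f = q) :
    IsBlockInverse Q (perturbedMul f B) R := by
  have hQR : Q * R = R := hQ.mul_eq hR hR hqρ
  have hRQ : R * Q = R := hR.mul_eq hQ hR (mul_comm q ρ ▸ hqρ)
  have hQQ : Q * Q = Q := hQ.mul_eq hQ hQ hq
  have hQBR : Q * B * R = 0 := by rw [← hQR, ← mul_assoc, hB, zero_mul]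
  have hRBQ : R * B * Q = 0 := by rw [← hRQ, mul_assoc, mul_assoc, ← mul_assoc Q, hB, mul_zero]
  refine ⟨by rw [hQR, hRQ], fun ψ => ?_, fun ψ hψ => ?_⟩
  · have hgraph : (R ψ, Q ψ + B (R ψ)) ∈ (perturbedMul f B).graph := by
      rw [mem_graph_perturbedMul]
      intro n
      rw [lp.coeFn_add, Pi.add_apply, hQ, hR, ← hρ, Pi.mul_apply]
      push_cast
      ring
    obtain ⟨hdom, h⟩ := (mem_graph_iff_exists _).1 hgraph
    refine ⟨hdom, ?_⟩
    rw [h, map_add, ← mul_apply_eq_comp, ← mul_apply_eq_comp, ← mul_apply_eq_comp,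
      hQQ, hQBR, zero_apply, add_zero]
  · have hgraph : ((ψ : Ltwo ι), R (perturbedMul f B ψ)) ∈
        (perturbedMul (ρ * f * q) (R * B * Q)).graph :=
      hR.mem_graph_compress hQ (hψ.symm ▸ LinearPMap.mem_graph _ ψ)
    rw [hRBQ, hρ, hq, mem_graph_perturbedMul] at hgraph
    ext n
    rw [hgraph, zero_apply, lp.coeFn_zero, Pi.zero_apply, add_zero, ← hQ, hψ]

theorem feshbach_perturbedMul {P : Ltwo ι →L[ℂ] Ltwo ι} {p : ι → ℝ} (hP : IsDiag P p)
    (hQ : IsDiag Q q) (hq : q * q = q) (hpq : p * q = 0) (hB : Q * B * Q = 0)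
    (hR : IsDiag R ρ) (hqρ : q * ρ = ρ) (hρ : ρ * f = q) :
    feshbach P Q (perturbedMul f B) =
      sandwich P (perturbedMul f B) - toP (P * B * R * B * P) := by
  have hinv := isBlockInverse_perturbedMul hQ hq hB hR hqρ hρ
  have hρp : ρ * f * p = 0 := by
    rw [← hqρ, mul_comm _ p, ← mul_assoc, ← mul_assoc, hpq, zero_mul, zero_mul]
  have hpρ : p * f * ρ = 0 := by rw [mul_assoc, mul_comm, mul_comm f, hρp]
  -- `P` and `R` live on complementary blocks, so between them only `B` survives.
  have hRζ : ∀ {ψ ζ}, (P ψ, ζ) ∈ (perturbedMul f B).graph → R ζ = (R * B * P) ψ := fun h =>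
    mem_graph_perturbedMul_zero.1 (hρp ▸ hR.mem_graph_compress hP h)
  have hPζ : ∀ {η ζ}, (R η, ζ) ∈ (perturbedMul f B).graph → P ζ = (P * B * R) η := fun h =>
    mem_graph_perturbedMul_zero.1 (hpρ ▸ hP.mem_graph_compress hR h)
  have hQRQ : ∀ ζ, Q (R (Q ζ)) = R ζ := fun ζ => by
    conv_rhs => rw [← hinv.block]
    rfl
  rw [feshbach, hinv.blockInv_eq (hQ.mul_eq hQ hQ hq)]
  refine linearPMap_ext_graph fun ψ χ => ?_
  simp only [mem_graph_sub, mem_graph_sandwich, mem_graph_prodP, mem_graph_toP]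
  constructor
  · rintro ⟨a, _, ha, ⟨ζ', ⟨_, ⟨_, ⟨_, ⟨ζ, ⟨_, rfl, hζ⟩, rfl⟩, rfl⟩, rfl⟩, hζ'⟩, rfl⟩, rfl⟩
    rw [hQRQ] at hζ'
    refine ⟨a, _, ha, ?_, rfl⟩
    rw [hPζ hζ', mul_apply_eq_comp (P * B), hRζ hζ]
    rfl
  · rintro ⟨_, _, ⟨ζ, hζ, rfl⟩, rfl, rfl⟩
    obtain ⟨hdom, -⟩ := hinv.right_inv ζ
    have hζ' := LinearPMap.mem_graph (perturbedMul f B) ⟨R ζ, hdom⟩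
    refine ⟨_, _, ⟨ζ, hζ, rfl⟩,
      ⟨_, ⟨_, ⟨_, ⟨_, ⟨ζ, ⟨_, rfl, hζ⟩, rfl⟩, rfl⟩, hQRQ ζ⟩, hζ'⟩, rfl⟩, ?_⟩
    rw [hPζ hζ', mul_apply_eq_comp (P * B), hRζ hζ]
    rfl

end Block

theorem single_mem_graph_perturbedMul [DecidableEq ι] (f : ι → ℝ) (B : Ltwo ι →L[ℂ] Ltwo ι)
    (i : ι) (c : ℂ) :
    (lp.single 2 i c, lp.single 2 i ((f i : ℂ) * c) + B (lp.single 2 i c)) ∈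
      (perturbedMul f B).graph := by
  rw [mem_graph_perturbedMul]
  intro n
  simp only [lp.coeFn_add, Pi.add_apply, lp.coeFn_single]
  by_cases hn : n = i
  · subst hn; simp
  · simp [hn]

theorem dense_domain_perturbedMul (f : ι → ℝ) (B : Ltwo ι →L[ℂ] Ltwo ι) :
    Dense ((perturbedMul f B).domain : Set (Ltwo ι)) := by
  classical
  intro ψ
  refine mem_closure_of_tendsto (lp.hasSum_single (by simp) ψ) (.of_forall fun s => ?_)
  exact Submodule.sum_mem _ fun i _ =>
    LinearPMap.mem_domain_of_mem_graph (single_mem_graph_perturbedMul f B i _)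

theorem isSelfAdjoint_perturbedMul (f : ι → ℝ) (hB : IsSelfAdjoint B) :
    IsSelfAdjoint (perturbedMul f B) := by
  classical
  have hsymm : ∀ ψ χ, inner ℂ (B ψ) χ = inner ℂ ψ (B χ) := fun ψ χ => hB.isSymmetric ψ χ
  rw [LinearPMap.isSelfAdjoint_def]
  refine linearPMap_ext_graph fun ψ χ => ?_
  rw [LinearPMap.adjoint_graph_eq_graph_adjoint (dense_domain_perturbedMul f B),
    Submodule.mem_adjoint_iff]
  constructor
  · intro h
    rw [mem_graph_perturbedMul]
    intro n
    have hn := h _ _ (single_mem_graph_perturbedMul f B n 1)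
    rw [inner_add_left, hsymm, lp.inner_single_left, lp.inner_single_left,
      lp.inner_single_left] at hn
    simp only [RCLike.inner_apply, map_one, Complex.conj_ofReal, mul_one] at hn
    linear_combination -hn
  · intro h a b hab
    rw [mem_graph_perturbedMul] at h hab
    have hmul : inner ℂ (b - B a) ψ = inner ℂ a (χ - B ψ) := by
      rw [lp.inner_eq_tsum, lp.inner_eq_tsum]
      refine tsum_congr fun n => ?_
      simp only [lp.coeFn_sub, Pi.sub_apply, h, hab, add_sub_cancel_right, RCLike.inner_apply,
        map_mul, Complex.conj_ofReal]
      ring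
    rw [inner_sub_left, inner_sub_right, hsymm] at hmul
    linear_combination hmul

end PerturbedMul

/-! ## The operators in the occupation-number basis -/

section Sector

variable {d N : ℕ}

theorem cre_ann_apply (l : Mode d) (ψ : Amp d) (n : Occ d) :
    cre l (ann l ψ) n = ((n l : ℝ) : ℂ) * ψ n := by
  rcases eq_or_ne (n l) 0 with h | h
  · simp [cre, h]
  · have hn : (((n - Finsupp.single l 1 : Occ d) l : ℕ) : ℝ) + 1 = n l := by
      have := congrArg (fun m : Occ d => (m l : ℝ)) (tsub_single_add_single h)
      simpa only [Finsupp.add_apply, Finsupp.single_eq_same, Nat.cast_add, Nat.cast_one] using this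
    simp only [cre, ann, LinearMap.coe_mk, AddHom.coe_mk]
    rw [tsub_single_add_single h, hn, ← mul_assoc, ← Complex.ofReal_mul,
      Real.mul_self_sqrt (Nat.cast_nonneg _)]

theorem extend_apply (ψ : Config d N → ℂ) (n : Config d N) : extend d N ψ n.1 = ψ n := by
  simp [extend, n.2]

theorem mem_graph_sectorOp {T : Amp d →ₗ[ℂ] Amp d} {ψ χ : FockN d N} :
    (ψ, χ) ∈ (sectorOp N T).graph ↔ ∀ n : Config d N, χ n = T (extend d N ψ) n.1 := by
  rw [mem_graph_iff_exists]
  constructor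
  · rintro ⟨h, rfl⟩ n
    rfl
  · intro h
    have hχ : (χ : Config d N → ℂ) = sectorMap N T ψ := funext h
    exact ⟨show Memℓp (sectorMap N T ψ) 2 from hχ ▸ lp.memℓp χ, Subtype.ext hχ.symm⟩

/-- Replaces a group `p` of particles by a group `p'` with as many particles; configurations which
do not contain `p` are left alone. -/
def exchange (p p' : Occ d) (h : p.degree = p'.degree) (n : Config d N) : Config d N :=
  if hp : p ≤ n.1 then
    ⟨n.1 - p + p', by rw [map_add, ← h, ← map_add, tsub_add_cancel_of_le hp, n.2]⟩
  else n

variable {p p' : Occ d} (h : p.degree = p'.degree) {n : Config d N}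

theorem exchange_val (hp : p ≤ n.1) : (exchange p p' h n).1 = n.1 - p + p' := by
  rw [exchange, dif_pos hp]

theorem exchange_exchange (hp : p ≤ n.1) : exchange p' p h.symm (exchange p p' h n) = n := by
  have hp' : p' ≤ (exchange p p' h n).1 := exchange_val h hp ▸ le_add_self
  apply Subtype.ext
  rw [exchange_val h.symm hp', exchange_val h hp, add_tsub_cancel_right, tsub_add_cancel_of_le hp]

end Sector

namespace ThreeModes

variable {d : ℕ} (S : ThreeModes d)

theorem neg_j_ne_j : -S.j ≠ S.j := fun h => S.j_ne_zero (self_eq_neg.1 h.symm)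

theorem neg_j_ne_zero : -S.j ≠ 0 := neg_ne_zero.2 S.j_ne_zero

/-- The occupation numbers of a pair of particles in the zero mode. -/
def zeroPair (d : ℕ) : Occ d := Finsupp.single 0 1 + Finsupp.single 0 1

/-- The occupation numbers of a pair of particles in the modes `±j`. -/
def modePair : Occ d := Finsupp.single S.j 1 + Finsupp.single (-S.j) 1

theorem degree_zeroPair : (zeroPair d).degree = S.modePair.degree := by
  simp [zeroPair, modePair]

theorem zeroPair_le_iff {n : Occ d} : zeroPair d ≤ n ↔ 2 ≤ n 0 := by
  rw [zeroPair, ← Finsupp.single_add]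
  simp

theorem zeroPair_apply_zero : zeroPair d 0 = 2 := by simp [zeroPair]

theorem zeroPair_apply_of_ne {l : Mode d} (hl : l ≠ 0) : zeroPair d l = 0 := by
  simp [zeroPair, hl]

theorem modePair_apply_zero : S.modePair 0 = 0 := by
  simp [modePair, S.j_ne_zero.symm, S.neg_j_ne_zero.symm]

theorem modePair_apply_j : S.modePair S.j = 1 := by
  simp [modePair, S.neg_j_ne_j.symm]

theorem modePair_apply_neg_j : S.modePair (-S.j) = 1 := by
  simp [modePair, S.neg_j_ne_j]

theorem modePair_le_iff {n : Occ d} : S.modePair ≤ n ↔ n S.j ≠ 0 ∧ n (-S.j) ≠ 0 := by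
  simp only [← Nat.one_le_iff_ne_zero]
  constructor
  · exact fun h => ⟨S.modePair_apply_j ▸ h S.j, S.modePair_apply_neg_j ▸ h (-S.j)⟩
  · rintro ⟨hj, hj'⟩ l
    by_cases h : l = S.j
    · rwa [h, S.modePair_apply_j]
    by_cases h' : l = -S.j
    · rwa [h', S.modePair_apply_neg_j]
    simp [modePair, h, h']

/-- The number of particles in the modes `±j`. -/
def pairCount (n : Config d S.N) : ℕ := n.1 S.j + n.1 (-S.j)

/-- Moves a pair of particles from the zero mode to the modes `±j`, if there is one. -/
def up : Config d S.N → Config d S.N := exchange (zeroPair d) S.modePair S.degree_zeroPair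

/-- Moves a pair of particles from the modes `±j` to the zero mode, if there is one. -/
def down : Config d S.N → Config d S.N := exchange S.modePair (zeroPair d) S.degree_zeroPair.symm

/-- The matrix element of `W` between `n` and `up n`. -/
def coefW (n : Config d S.N) : ℝ :=
  S.phi / S.N * (√(n.1 0) * √((n.1 0 - 1 : ℕ)) * √(n.1 S.j + 1) * √(n.1 (-S.j) + 1))

/-- The matrix element of `W^*` between `n` and `down n`. -/
def coefWstar (n : Config d S.N) : ℝ :=
  S.phi / S.N * (√(n.1 0 + 1) * √(n.1 0 + 1 + 1) * √(n.1 S.j) * √(n.1 (-S.j)))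

variable {S} {n : Config d S.N}

theorem zeroPair_le_of_coefW_ne_zero (h : S.coefW n ≠ 0) : zeroPair d ≤ n.1 := by
  rw [zeroPair_le_iff]
  contrapose! h
  have : n.1 0 - 1 = 0 := by lia
  simp [coefW, this]

theorem modePair_le_of_coefWstar_ne_zero (h : S.coefWstar n ≠ 0) : S.modePair ≤ n.1 := by
  rw [modePair_le_iff]
  constructor <;> intro h0 <;> simp [coefWstar, h0] at h

theorem up_apply_zero (h : zeroPair d ≤ n.1) : (S.up n).1 0 + 2 = n.1 0 := by
  rw [up, exchange_val _ h, Finsupp.add_apply, Finsupp.tsub_apply, modePair_apply_zero,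
    zeroPair_apply_zero]
  have := zeroPair_le_iff.1 h
  lia

theorem up_apply_j (h : zeroPair d ≤ n.1) : (S.up n).1 S.j = n.1 S.j + 1 := by
  rw [up, exchange_val _ h, Finsupp.add_apply, Finsupp.tsub_apply, modePair_apply_j,
    zeroPair_apply_of_ne S.j_ne_zero, tsub_zero]

theorem up_apply_neg_j (h : zeroPair d ≤ n.1) : (S.up n).1 (-S.j) = n.1 (-S.j) + 1 := by
  rw [up, exchange_val _ h, Finsupp.add_apply, Finsupp.tsub_apply, modePair_apply_neg_j,
    zeroPair_apply_of_ne S.neg_j_ne_zero, tsub_zero]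

theorem pairCount_up (h : zeroPair d ≤ n.1) : S.pairCount (S.up n) = S.pairCount n + 2 := by
  rw [pairCount, pairCount, up_apply_j h, up_apply_neg_j h]
  lia

theorem down_up (h : zeroPair d ≤ n.1) : S.down (S.up n) = n := exchange_exchange _ h

theorem up_down (h : S.modePair ≤ n.1) : S.up (S.down n) = n := exchange_exchange _ h

theorem zeroPair_le_down (h : S.modePair ≤ n.1) : zeroPair d ≤ (S.down n).1 := by
  rw [down, exchange_val _ h]
  exact le_add_self

theorem coefWstar_up (h : zeroPair d ≤ n.1) : S.coefWstar (S.up n) = S.coefW n := by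
  have hn : (n.1 0 - 1 : ℕ) = (S.up n).1 0 + 1 := by have := up_apply_zero h; lia
  rw [coefWstar, coefW, up_apply_j h, up_apply_neg_j h, hn, ← up_apply_zero h]
  push_cast
  ring_nf

theorem coefW_down (h : S.modePair ≤ n.1) : S.coefW (S.down n) = S.coefWstar n := by
  rw [← coefWstar_up (zeroPair_le_down h), up_down h]

theorem coefW_sq : S.coefW n ^ 2 = (S.phi / S.N) ^ 2 *
    ((n.1 0 : ℝ) * (n.1 0 - 1) * (n.1 S.j + 1) * (n.1 (-S.j) + 1)) := by
  have h : (n.1 0 : ℝ) * ((n.1 0 - 1 : ℕ) : ℝ) = n.1 0 * (n.1 0 - 1) := by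
    rcases Nat.eq_zero_or_pos (n.1 0) with h | h
    · simp [h]
    · rw [Nat.cast_sub h, Nat.cast_one]
  rw [coefW, mul_pow, mul_pow, mul_pow, mul_pow, Real.sq_sqrt (by positivity),
    Real.sq_sqrt (by positivity), Real.sq_sqrt (by positivity), Real.sq_sqrt (by positivity), h]

variable (S)

theorem isWeightedShift_W : IsWeightedShift S.W S.coefW S.up := by
  intro ψ n
  have hW : S.W ψ n = S.coefW n * extend d S.N ψ (n.1 - zeroPair d + S.modePair) := by
    change S.WAmp (extend d S.N ψ) n.1 = _
    simp [WAmp, cre, ann, coefW, zeroPair, modePair, tsub_add_eq_tsub_tsub, ← add_assoc,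
      S.j_ne_zero, S.neg_j_ne_zero, S.neg_j_ne_j]
    ring
  rw [hW]
  rcases eq_or_ne (S.coefW n) 0 with h | h
  · simp [h]
  · rw [← exchange_val S.degree_zeroPair (zeroPair_le_of_coefW_ne_zero h), extend_apply, up]

theorem isWeightedShift_Wstar : IsWeightedShift S.Wstar S.coefWstar S.down := by
  intro ψ n
  have hW : S.Wstar ψ n = S.coefWstar n * extend d S.N ψ (n.1 + zeroPair d - S.modePair) := by
    change S.WstarAmp (extend d S.N ψ) n.1 = _
    simp [WstarAmp, cre, ann, coefWstar, zeroPair, modePair, tsub_add_eq_tsub_tsub, ← add_assoc,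
      S.j_ne_zero, S.neg_j_ne_zero, S.neg_j_ne_j]
    ring
  rw [hW]
  rcases eq_or_ne (S.coefWstar n) 0 with h | h
  · simp [h]
  · have hn := modePair_le_of_coefWstar_ne_zero h
    rw [← tsub_add_eq_add_tsub hn, ← exchange_val S.degree_zeroPair.symm hn, extend_apply, down]

theorem down_up_of_coefW_ne_zero (n : Config d S.N) (h : S.coefW n ≠ 0) :
    S.down (S.up n) = n ∧ S.coefWstar (S.up n) = S.coefW n :=
  have hn := zeroPair_le_of_coefW_ne_zero h
  ⟨down_up hn, coefWstar_up hn⟩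

theorem up_down_of_coefWstar_ne_zero (n : Config d S.N) (h : S.coefWstar n ≠ 0) :
    S.up (S.down n) = n ∧ S.coefW (S.down n) = S.coefWstar n :=
  have hn := modePair_le_of_coefWstar_ne_zero h
  ⟨up_down hn, coefW_down hn⟩

theorem star_W : star S.W = S.Wstar :=
  S.isWeightedShift_W.star_eq S.isWeightedShift_Wstar S.down_up_of_coefW_ne_zero
    S.up_down_of_coefWstar_ne_zero

/-- The diagonal part of the Hamiltonian. -/
def energy (n : Config d S.N) : ℝ :=
  (∑ l ∈ n.1.support with l ≠ S.j ∧ l ≠ -S.j, S.ksq l * n.1 l) +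
    (S.ksq S.j + S.phi / S.N * n.1 0) * S.pairCount n

theorem HBog_eq : S.HBog = perturbedMul S.energy (S.W + S.Wstar) := by
  refine linearPMap_ext_graph fun ψ χ => ?_
  rw [HBog, mem_graph_sectorOp, mem_graph_perturbedMul]
  refine forall_congr' fun n => ?_
  have hkin : S.kinAmp (extend d S.N ψ) n.1 =
      ((∑ l ∈ n.1.support with l ≠ S.j ∧ l ≠ -S.j, S.ksq l * n.1 l : ℝ) : ℂ) * ψ n := by
    simp only [kinAmp, LinearMap.coe_mk, AddHom.coe_mk, cre_ann_apply, extend_apply,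
      Complex.ofReal_sum, Complex.ofReal_mul, Finset.sum_mul, mul_assoc]
  have hH0 : S.H0Amp (extend d S.N ψ) n.1 =
      (((S.ksq S.j + S.phi / S.N * n.1 0) * S.pairCount n : ℝ) : ℂ) * ψ n := by
    simp only [H0Amp, LinearMap.comp_apply, LinearMap.add_apply, LinearMap.smul_apply,
      LinearMap.id_apply, Pi.add_apply, Pi.smul_apply, map_add, cre_ann_apply, extend_apply,
      smul_eq_mul, pairCount]
    push_cast
    ring
  have hsum : (S.kinAmp + (S.H0Amp + S.WAmp + S.WstarAmp)) (extend d S.N ψ) n.1 =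
      S.kinAmp (extend d S.N ψ) n.1 + (S.H0Amp (extend d S.N ψ) n.1 + S.W ψ n + S.Wstar ψ n) := rfl
  rw [hsum, hkin, hH0, add_apply, lp.coeFn_add, Pi.add_apply, energy]
  push_cast
  ring_nf

/-- The diagonal part of `H - z`. -/
def energySub (z : ℝ) (n : Config d S.N) : ℝ := S.energy n - z

theorem HSub_eq (z : ℝ) : S.HSub z = perturbedMul (S.energySub z) (S.W + S.Wstar) := by
  have hz : IsDiag ((z : ℂ) • (1 : FockN d S.N →L[ℂ] FockN d S.N)) fun _ => z := fun ψ n => by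
    rw [smul_apply, one_apply_eq_self, lp.coeFn_smul, Pi.smul_apply, smul_eq_mul]
  rw [HSub, HBog_eq, perturbedMul_sub_toP, hz.perturbedMul_sub]
  rfl

theorem isDiag_proj (A : Set (Occ d)) [DecidablePred (· ∈ A)] :
    IsDiag (S.proj A) (fun n => if n.1 ∈ A then 1 else 0) := by
  intro ψ n
  have hA : S.proj A ψ n =
      @ite _ (n.1 ∈ A) (Classical.propDecidable _) (extend d S.N ψ n.1) 0 := rfl
  rw [hA, extend_apply]
  by_cases h : n.1 ∈ A <;> simp [h]

end ThreeModes

/-! ## The Feshbach–Schur flow -/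

namespace ThreeModes

variable {d : ℕ} (S : ThreeModes d)

/-- The orthogonal projection onto the vectors with at most `N - i` particles in the modes `±j`. -/
def below (i : ℕ) : FockN d S.N →L[ℂ] FockN d S.N :=
  S.proj {n | n S.j + n (-S.j) + i ≤ S.N}

/-- The diagonal of `below i`. -/
def belowInd (i : ℕ) (n : Config d S.N) : ℝ := if S.pairCount n + i ≤ S.N then 1 else 0

/-- The diagonal of `Q^{(i,i+1)}`. -/
def qInd (i : ℕ) (n : Config d S.N) : ℝ :=
  if S.pairCount n + i = S.N ∨ S.pairCount n + (i + 1) = S.N then 1 else 0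

theorem QGt_eq_below (i : ℕ) : S.QGt i = S.below (i + 2) := rfl

theorem isDiag_below (i : ℕ) : IsDiag (S.below i) (S.belowInd i) :=
  S.isDiag_proj {n | n S.j + n (-S.j) + i ≤ S.N}

theorem isDiag_Q (i : ℕ) : IsDiag (S.Q i) (S.qInd i) :=
  S.isDiag_proj {n | n S.j + n (-S.j) + i = S.N ∨ n S.j + n (-S.j) + (i + 1) = S.N}

variable {S} in
theorem zero_add_pairCount_le (n : Config d S.N) : n.1 0 + S.pairCount n ≤ S.N := by
  have hdeg : ∑ l ∈ ({0, S.j, -S.j} : Finset (Mode d)), n.1 l ≤ n.1.degree :=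
    Finset.sum_le_sum_of_ne_zero fun l _ hl => Finsupp.mem_support_iff.2 hl
  rw [Finset.sum_insert (by simp [S.j_ne_zero.symm, S.neg_j_ne_zero.symm]),
    Finset.sum_pair S.neg_j_ne_j.symm, n.2] at hdeg
  exact hdeg

theorem belowInd_zero : S.belowInd 0 = 1 := by
  funext n
  have := zero_add_pairCount_le n
  rw [belowInd, if_pos (by lia), Pi.one_apply]

theorem qInd_mul_self (i : ℕ) : S.qInd i * S.qInd i = S.qInd i := by
  funext n
  simp only [Pi.mul_apply, qInd]
  split_ifs <;> simp

theorem belowInd_mul_self (i : ℕ) : S.belowInd i * S.belowInd i = S.belowInd i := by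
  funext n
  simp only [Pi.mul_apply, belowInd]
  split_ifs <;> simp

theorem belowInd_mul_qInd (i : ℕ) : S.belowInd i * S.qInd i = S.qInd i := by
  funext n
  simp only [Pi.mul_apply, belowInd, qInd]
  split_ifs <;> lia

theorem belowInd_add_two_mul (i : ℕ) : S.belowInd (i + 2) * S.belowInd i = S.belowInd (i + 2) := by
  funext n
  simp only [Pi.mul_apply, belowInd]
  split_ifs <;> lia

theorem belowInd_add_two_mul_qInd (i : ℕ) : S.belowInd (i + 2) * S.qInd i = 0 := by
  funext n
  simp only [Pi.mul_apply, Pi.zero_apply, belowInd, qInd]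
  split_ifs <;> lia

theorem below_mul_Q (i : ℕ) : S.below i * S.Q i = S.Q i :=
  (S.isDiag_below i).mul_eq (S.isDiag_Q i) (S.isDiag_Q i) (S.belowInd_mul_qInd i)

theorem Q_mul_below (i : ℕ) : S.Q i * S.below i = S.Q i :=
  (S.isDiag_Q i).mul_eq (S.isDiag_below i) (S.isDiag_Q i)
    (mul_comm (S.belowInd i) _ ▸ S.belowInd_mul_qInd i)

theorem below_add_two_mul (i : ℕ) : S.below (i + 2) * S.below i = S.below (i + 2) :=
  (S.isDiag_below _).mul_eq (S.isDiag_below i) (S.isDiag_below _) (S.belowInd_add_two_mul i)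

theorem below_mul_add_two (i : ℕ) : S.below i * S.below (i + 2) = S.below (i + 2) :=
  (S.isDiag_below i).mul_eq (S.isDiag_below _) (S.isDiag_below _)
    (mul_comm (S.belowInd (i + 2)) _ ▸ S.belowInd_add_two_mul i)

variable {S}

theorem pairCount_up_of_coefW_ne_zero {n : Config d S.N} (h : S.coefW n ≠ 0) :
    S.pairCount (S.up n) = S.pairCount n + 2 :=
  pairCount_up (zeroPair_le_of_coefW_ne_zero h)

theorem pairCount_down_of_coefWstar_ne_zero {n : Config d S.N} (h : S.coefWstar n ≠ 0) :
    S.pairCount (S.down n) + 2 = S.pairCount n := by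
  have hn := modePair_le_of_coefWstar_ne_zero h
  rw [← pairCount_up (zeroPair_le_down hn), up_down hn]

theorem qInd_up {n : Config d S.N} (h : S.coefW n ≠ 0) (i : ℕ) :
    S.qInd i (S.up n) = S.qInd (i + 2) n := by
  simp only [qInd, pairCount_up_of_coefW_ne_zero h]
  congr 1
  simp only [eq_iff_iff]
  lia

variable (S)

theorem Q_mul_W_mul_Q (i : ℕ) : S.Q i * S.W * S.Q i = 0 := by
  refine S.isWeightedShift_W.mul_mul_eq_zero (S.isDiag_Q i) (S.isDiag_Q i) fun n h => ?_
  simp only [qInd, pairCount_up_of_coefW_ne_zero h]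
  split_ifs <;> lia

theorem Q_mul_W_mul_QGt (i : ℕ) : S.Q i * S.W * S.QGt i = 0 := by
  refine S.isWeightedShift_W.mul_mul_eq_zero (S.isDiag_Q i) (S.isDiag_below (i + 2)) fun n h => ?_
  simp only [qInd, belowInd, pairCount_up_of_coefW_ne_zero h]
  split_ifs <;> lia

theorem Q_mul_Wstar_mul_Q (i : ℕ) : S.Q i * S.Wstar * S.Q i = 0 := by
  refine S.isWeightedShift_Wstar.mul_mul_eq_zero (S.isDiag_Q i) (S.isDiag_Q i) fun n h => ?_
  have := pairCount_down_of_coefWstar_ne_zero h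
  simp only [qInd]
  split_ifs <;> lia

theorem QGt_mul_Wstar_mul_Q (i : ℕ) : S.QGt i * S.Wstar * S.Q i = 0 := by
  refine S.isWeightedShift_Wstar.mul_mul_eq_zero (S.isDiag_below (i + 2)) (S.isDiag_Q i)
    fun n h => ?_
  have := pairCount_down_of_coefWstar_ne_zero h
  simp only [qInd, belowInd]
  split_ifs <;> lia

theorem Q_mul_W_add_Wstar_mul_Q (i : ℕ) : S.Q i * (S.W + S.Wstar) * S.Q i = 0 := by
  rw [mul_add, add_mul, Q_mul_W_mul_Q, Q_mul_Wstar_mul_Q, add_zero]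

theorem ksq_nonneg (l : Mode d) : 0 ≤ S.ksq l := Finset.sum_nonneg fun _ _ => sq_nonneg _

variable {S} in
theorem le_energy (n : Config d S.N) :
    (S.ksq S.j + S.phi / S.N * n.1 0) * S.pairCount n ≤ S.energy n :=
  le_add_of_nonneg_left <|
    Finset.sum_nonneg fun l _ => mul_nonneg (S.ksq_nonneg l) (Nat.cast_nonneg _)

variable {S} in
theorem energy_nonneg (n : Config d S.N) : 0 ≤ S.energy n := by
  refine le_trans ?_ (le_energy n)
  have := S.ksq_nonneg S.j
  have := S.phi_pos
  positivity

/-- The diagonal of `R_{i,i}(z)`. -/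
def rho (z : ℝ) (i : ℕ) : Config d S.N → ℝ := S.qInd i * (S.energySub z)⁻¹

theorem qInd_mul_rho (z : ℝ) (i : ℕ) : S.qInd i * S.rho z i = S.rho z i := by
  rw [rho, ← mul_assoc, qInd_mul_self]

section Resolvent

variable {S} {z : ℝ}

theorem energySub_pos (hz : z < 0) (n : Config d S.N) : 0 < S.energySub z n :=
  sub_pos.2 (hz.trans_le (energy_nonneg n))

theorem rho_nonneg (hz : z < 0) (i : ℕ) : 0 ≤ S.rho z i := fun n => by
  refine mul_nonneg ?_ (inv_nonneg.2 (energySub_pos hz n).le)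
  rw [qInd]
  split_ifs <;> simp

theorem rho_le_inv (hz : z < 0) (i : ℕ) (n : Config d S.N) : S.rho z i n ≤ (S.energySub z n)⁻¹ := by
  refine mul_le_of_le_one_left (inv_nonneg.2 (energySub_pos hz n).le) ?_
  rw [qInd]
  split_ifs <;> simp

theorem rho_mul_energySub (hz : z < 0) (i : ℕ) : S.rho z i * S.energySub z = S.qInd i :=
  funext fun n => inv_mul_cancel_right₀ (energySub_pos hz n).ne' _

variable (S)

theorem exists_isDiag_rho (hz : z < 0) (i : ℕ) :
    ∃ A : FockN d S.N →L[ℂ] FockN d S.N, IsDiag A (S.rho z i) := by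
  refine exists_isDiag (C := (-z)⁻¹) (inv_nonneg.2 (by linarith)) fun n => ?_
  have hn := energy_nonneg n
  rw [abs_of_nonneg (rho_nonneg hz i n)]
  exact (rho_le_inv hz i n).trans (inv_anti₀ (by linarith) (by rw [energySub]; linarith))

theorem isBlockInverse_HSub (hz : z < 0) {i : ℕ} {A : FockN d S.N →L[ℂ] FockN d S.N}
    (hA : IsDiag A (S.rho z i)) : IsBlockInverse (S.Q i) (S.HSub z) A :=
  S.HSub_eq z ▸ isBlockInverse_perturbedMul (S.isDiag_Q i) (S.qInd_mul_self i)
    (S.Q_mul_W_add_Wstar_mul_Q i) hA (S.qInd_mul_rho z i) (rho_mul_energySub hz i)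

theorem blockInvertible_HSub (hz : z < 0) (i : ℕ) : BlockInvertible (S.Q i) (S.HSub z) :=
  (S.exists_isDiag_rho hz i).imp fun _ hA => S.isBlockInverse_HSub hz hA

theorem isDiag_R (hz : z < 0) (i : ℕ) : IsDiag (S.R z i) (S.rho z i) := by
  obtain ⟨A, hA⟩ := S.exists_isDiag_rho hz i
  have hQ : S.Q i * S.Q i = S.Q i :=
    (S.isDiag_Q i).mul_eq (S.isDiag_Q i) (S.isDiag_Q i) (S.qInd_mul_self i)
  rwa [R, (S.isBlockInverse_HSub hz hA).blockInv_eq hQ]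

theorem isDiag_Rsqrt (hz : z < 0) (i : ℕ) : IsDiag (S.Rsqrt z i) (fun n => √(S.rho z i n)) :=
  (S.isDiag_R hz i).opSqrt (rho_nonneg hz i)

theorem R_nonneg (hz : z < 0) (i : ℕ) : 0 ≤ S.R z i := (S.isDiag_R hz i).nonneg (rho_nonneg hz i)

end Resolvent

/-- The diagonal of `Γ_{i,i}(z)`, `i = 2 s`. -/
def gam (z : ℝ) : ℕ → Config d S.N → ℝ
  | 0 => 0
  | s + 1 => fun n =>
      S.coefW n ^ 2 * (S.rho z (2 * s) * (1 - gam z s * S.rho z (2 * s))⁻¹) (S.up n)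

/-- The diagonal of `resummed z s`. -/
def dressed (z : ℝ) (s : ℕ) : Config d S.N → ℝ :=
  S.rho z (2 * s) * (1 - S.gam z s * S.rho z (2 * s))⁻¹

/-- The resummed propagator `R_{i,i} ∑_l (Γ_{i,i} R_{i,i})^l`, `i = 2 s`. -/
def resummed (z : ℝ) (s : ℕ) : FockN d S.N →L[ℂ] FockN d S.N :=
  S.R z (2 * s) * ∑' l : ℕ, (S.Gam z s * S.R z (2 * s)) ^ l

theorem qInd_mul_dressed (z : ℝ) (s : ℕ) : S.qInd (2 * s) * S.dressed z s = S.dressed z s := by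
  rw [dressed, ← mul_assoc, qInd_mul_rho]

theorem qInd_mul_gam (z : ℝ) (s : ℕ) : S.qInd (2 * s) * S.gam z s = S.gam z s := by
  cases s with
  | zero => exact mul_zero _
  | succ s =>
    funext n
    change S.qInd (2 * s + 2) n * (S.coefW n ^ 2 * S.dressed z s (S.up n)) =
      S.coefW n ^ 2 * S.dressed z s (S.up n)
    rcases eq_or_ne (S.coefW n) 0 with h | h
    · simp [h]
    · rw [← qInd_up h, mul_left_comm, ← Pi.mul_apply, qInd_mul_dressed]

theorem belowInd_mul_gam (z : ℝ) (s : ℕ) :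
    S.belowInd (2 * s) * S.gam z s = S.gam z s := by
  rw [← qInd_mul_gam, ← mul_assoc, belowInd_mul_qInd]

theorem belowInd_add_two_mul_gam (z : ℝ) (s : ℕ) :
    S.belowInd (2 * s + 2) * S.gam z s = 0 := by
  rw [← qInd_mul_gam, ← mul_assoc, belowInd_add_two_mul_qInd, zero_mul]

theorem resummed_zero (z : ℝ) : S.resummed z 0 = S.R z 0 := by
  rw [resummed, Gam, zero_mul, mul_zero, tsum_eq_single 0 fun l hl => zero_pow hl, pow_zero,
    mul_one]

theorem Gam_succ (z : ℝ) (s : ℕ) :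
    S.Gam z (s + 1) = S.Wblock (2 * (s + 1)) (2 * s) * S.resummed z s *
      S.Wstarblock (2 * s) (2 * (s + 1)) := by
  cases s with
  | zero => rw [resummed_zero]; rfl
  | succ s => rw [resummed, ← mul_assoc]; rfl

theorem isDiag_W_mul_resummed_mul_Wstar {S : ThreeModes d} {z : ℝ} {s : ℕ}
    (hR : IsDiag (S.resummed z s) (S.dressed z s)) :
    IsDiag (S.W * S.resummed z s * S.Wstar) (S.gam z (s + 1)) :=
  S.isWeightedShift_W.isDiag_mul_mul hR S.isWeightedShift_Wstar S.down_up_of_coefW_ne_zero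

/-- The explicit form of `K^{(i-2)}(z)`, `i = 2 s`: the compression of `H - z` to the range of
`below i`, minus the operator `Γ_{i,i}(z)`, which is diagonal and lives on `Q^{(i,i+1)}`. -/
def flowHamiltonian (z : ℝ) (s : ℕ) : FockN d S.N →ₗ.[ℂ] FockN d S.N :=
  perturbedMul (S.belowInd (2 * s) * S.energySub z - S.gam z s)
    (S.below (2 * s) * (S.W + S.Wstar) * S.below (2 * s))

theorem Q_mul_interaction_mul_Q (i : ℕ) :
    S.Q i * (S.below i * (S.W + S.Wstar) * S.below i) * S.Q i = 0 := by
  calc S.Q i * (S.below i * (S.W + S.Wstar) * S.below i) * S.Q i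
      = S.Q i * S.below i * (S.W + S.Wstar) * (S.below i * S.Q i) := by simp only [mul_assoc]
    _ = 0 := by rw [S.Q_mul_below, S.below_mul_Q, S.Q_mul_W_add_Wstar_mul_Q]

theorem below_mul_interaction_mul_Q (i : ℕ) :
    S.below (i + 2) * (S.below i * (S.W + S.Wstar) * S.below i) * S.Q i =
      S.below (i + 2) * S.W * S.Q i := by
  have h0 : S.below (i + 2) * S.Wstar * S.Q i = 0 := S.QGt_mul_Wstar_mul_Q i
  simp only [← mul_assoc, S.below_add_two_mul]
  rw [mul_assoc _ (S.below i), S.below_mul_Q, mul_add, add_mul, h0, add_zero]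

theorem Q_mul_interaction_mul_below (i : ℕ) :
    S.Q i * (S.below i * (S.W + S.Wstar) * S.below i) * S.below (i + 2) =
      S.Q i * S.Wstar * S.below (i + 2) := by
  have h0 : S.Q i * S.W * S.below (i + 2) = 0 := S.Q_mul_W_mul_QGt i
  simp only [← mul_assoc, S.Q_mul_below]
  rw [mul_assoc _ (S.below i), S.below_mul_add_two, mul_add, add_mul, h0, zero_add]

theorem flowHamiltonian_zero (z : ℝ) : S.flowHamiltonian z 0 = S.HSub z := by
  have hbelow : S.below 0 = 1 := (S.isDiag_below 0).eq (S.belowInd_zero ▸ IsDiag.one)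
  rw [flowHamiltonian, mul_zero, hbelow, belowInd_zero, gam, one_mul, one_mul, mul_one, sub_zero,
    HSub_eq]

/-- The hypotheses under which the Neumann series of the flow converge, with `Γ̌_{i,i}` bounded by
`1 / X s` at `i = 2 s`: `step` says that each link of the continued fraction which defines the
diagonal of `Γ_{i,i} R_{i,i}` is dominated by the corresponding link of `X`. -/
structure FlowBound (z : ℝ) (X : ℕ → ℝ) : Prop where
  neg : z < 0
  zero : X 0 ≤ 1
  pos : ∀ s, 2 * s + 2 ≤ S.N → 0 < X s
  step : ∀ s n, 2 * (s + 1) + 2 ≤ S.N →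
    S.coefW n ^ 2 * S.rho z (2 * s) (S.up n) * S.rho z (2 * (s + 1)) n ≤ (1 - X (s + 1)) * X s

namespace FlowBound

variable {S} {z : ℝ} {X : ℕ → ℝ} (hX : S.FlowBound z X)

include hX

theorem gam_mul_rho_mem (s : ℕ) (hs : 2 * s + 2 ≤ S.N) (n : Config d S.N) :
    (S.gam z s * S.rho z (2 * s)) n ∈ Set.Icc 0 (1 - X s) := by
  induction s generalizing n with
  | zero => simpa [gam] using hX.zero
  | succ s ih =>
    have hXs := hX.pos s (by lia)
    have hstep := hX.step s n hs
    set t := S.coefW n ^ 2 * S.rho z (2 * s) (S.up n) * S.rho z (2 * (s + 1)) n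
    set D := 1 - (S.gam z s * S.rho z (2 * s)) (S.up n)
    have hgam : (S.gam z (s + 1) * S.rho z (2 * (s + 1))) n = t / D := by
      simp only [gam, Pi.mul_apply, Pi.inv_apply, Pi.sub_apply, Pi.one_apply, t, D]
      ring
    have hD : X s ≤ D := by linarith [(ih (by lia) (S.up n)).2]
    have ht : 0 ≤ t := mul_nonneg (mul_nonneg (sq_nonneg _) (rho_nonneg hX.neg _ _))
      (rho_nonneg hX.neg _ n)
    have hX' : 0 ≤ 1 - X (s + 1) := nonneg_of_mul_nonneg_left (ht.trans hstep) hXs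
    rw [hgam, Set.mem_Icc, div_le_iff₀ (hXs.trans_le hD)]
    exact ⟨div_nonneg ht (hXs.le.trans hD), hstep.trans (mul_le_mul_of_nonneg_left hD hX')⟩

theorem norm_lt_one {s : ℕ} (hs : 2 * s + 2 ≤ S.N) {A : FockN d S.N →L[ℂ] FockN d S.N}
    (hA : IsDiag A (S.gam z s * S.rho z (2 * s))) : ‖A‖ < 1 := by
  have hmem := hX.gam_mul_rho_mem s hs
  have hnonneg : 0 ≤ 1 - X s :=
    Set.nonempty_Icc.1 ⟨_, hmem ⟨Finsupp.single 0 S.N, by simp⟩⟩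
  have hle : ‖A‖ ≤ 1 - X s := hA.norm_le hnonneg fun n => by
    rw [abs_of_nonneg (hmem n).1]
    exact (hmem n).2
  linarith [hX.pos s hs]

theorem isDiag_resummed {s : ℕ} (hs : 2 * s + 2 ≤ S.N) (hΓ : IsDiag (S.Gam z s) (S.gam z s)) :
    IsDiag (S.resummed z s) (S.dressed z s) :=
  have hΓR := hΓ.mul (S.isDiag_R hX.neg (2 * s))
  (S.isDiag_R hX.neg (2 * s)).mul (hΓR.tsum_pow (hX.norm_lt_one hs hΓR))

theorem isDiag_Gam (s : ℕ) (hs : 2 * s ≤ S.N) : IsDiag (S.Gam z s) (S.gam z s) := by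
  induction s with
  | zero => exact IsDiag.zero
  | succ s ih =>
    have hR := hX.isDiag_resummed hs (ih (by lia))
    have hq := S.isDiag_Q (2 * s)
    have hq' := S.isDiag_Q (2 * (s + 1))
    have hQRQ : S.Q (2 * s) * S.resummed z s * S.Q (2 * s) = S.resummed z s :=
      (hq.mul hR).mul_eq hq hR (by rw [qInd_mul_dressed, mul_comm, qInd_mul_dressed])
    have hGam : S.Gam z (s + 1) =
        S.Q (2 * (s + 1)) * (S.W * S.resummed z s * S.Wstar) * S.Q (2 * (s + 1)) := by
      conv_rhs => rw [← hQRQ]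
      simp only [Gam_succ, Wblock, Wstarblock, mul_assoc]
    have hdiag := (hq'.mul (isDiag_W_mul_resummed_mul_Wstar hR)).mul hq'
    rwa [← hGam, qInd_mul_gam, mul_comm, qInd_mul_gam] at hdiag

theorem isDiag_dressed {s : ℕ} (hs : 2 * s + 2 ≤ S.N) : IsDiag (S.resummed z s) (S.dressed z s) :=
  hX.isDiag_resummed hs (hX.isDiag_Gam s (by lia))

theorem Q_mul_resummed {s : ℕ} (hs : 2 * s + 2 ≤ S.N) :
    S.Q (2 * s) * S.resummed z s = S.resummed z s :=
  (S.isDiag_Q _).mul_eq (hX.isDiag_dressed hs) (hX.isDiag_dressed hs) (S.qInd_mul_dressed z s)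

theorem resummed_mul_Q {s : ℕ} (hs : 2 * s + 2 ≤ S.N) :
    S.resummed z s * S.Q (2 * s) = S.resummed z s :=
  (hX.isDiag_dressed hs).mul_eq (S.isDiag_Q _) (hX.isDiag_dressed hs)
    (by rw [mul_comm, qInd_mul_dressed])

theorem dressed_mul {s : ℕ} (hs : 2 * s + 2 ≤ S.N) :
    S.dressed z s * (S.belowInd (2 * s) * S.energySub z - S.gam z s) = S.qInd (2 * s) := by
  have hrho : S.rho z (2 * s) * (S.belowInd (2 * s) * S.energySub z - S.gam z s) =
      S.qInd (2 * s) * (1 - S.gam z s * S.rho z (2 * s)) := by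
    linear_combination S.belowInd (2 * s) * rho_mul_energySub (S := S) hX.neg (2 * s) +
      S.belowInd_mul_qInd (2 * s) + S.gam z s * S.qInd_mul_rho z (2 * s)
  funext n
  have hne : 1 - (S.gam z s * S.rho z (2 * s)) n ≠ 0 := by
    linarith [(hX.gam_mul_rho_mem s hs n).2, hX.pos s hs]
  rw [dressed, mul_right_comm, hrho]
  exact mul_inv_cancel_right₀ hne _

theorem isBlockInverse_flow {s : ℕ} (hs : 2 * s + 2 ≤ S.N) :
    IsBlockInverse (S.Q (2 * s)) (S.flowHamiltonian z s) (S.resummed z s) :=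
  isBlockInverse_perturbedMul (S.isDiag_Q _) (S.qInd_mul_self _) (S.Q_mul_interaction_mul_Q _)
    (hX.isDiag_dressed hs) (S.qInd_mul_dressed z s) (hX.dressed_mul hs)

theorem feshbach_flowHamiltonian {s : ℕ} (hs : 2 * s + 2 ≤ S.N) :
    feshbach (S.QGt (2 * s)) (S.Q (2 * s)) (S.flowHamiltonian z s) =
      sandwich (S.QGt (2 * s)) (S.HSub z) -
        toP (S.QGt (2 * s) * S.W * S.resummed z s * S.Wstar * S.QGt (2 * s)) := by
  have hp := S.isDiag_below (2 * s + 2)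
  have hpp := S.belowInd_mul_self (2 * s + 2)
  rw [flowHamiltonian, S.QGt_eq_below, feshbach_perturbedMul hp (S.isDiag_Q _) (S.qInd_mul_self _)
    (S.belowInd_add_two_mul_qInd _) (S.Q_mul_interaction_mul_Q _) (hX.isDiag_dressed hs)
    (S.qInd_mul_dressed z s) (hX.dressed_mul hs), HSub_eq, sandwich_perturbedMul hp hpp,
    sandwich_perturbedMul hp hpp]
  congr 2
  · rw [mul_sub, ← mul_assoc, belowInd_add_two_mul, belowInd_add_two_mul_gam, sub_zero]
  · simp only [← mul_assoc, S.below_add_two_mul]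
    rw [mul_assoc _ (S.below (2 * s)), S.below_mul_add_two]
  · have key (A C : FockN d S.N →L[ℂ] FockN d S.N) : A * S.resummed z s * C =
        (A * S.Q (2 * s)) * S.resummed z s * (S.Q (2 * s) * C) := by
      conv_lhs => rw [← hX.Q_mul_resummed hs, ← hX.resummed_mul_Q hs]
      simp only [mul_assoc]
    rw [mul_assoc _ _ (S.below (2 * s + 2)), key, ← mul_assoc (S.Q _),
      S.below_mul_interaction_mul_Q, S.Q_mul_interaction_mul_below, mul_assoc _ S.Wstar,
      key (_ * S.W)]
    simp only [mul_assoc]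

theorem sandwich_HSub_sub {s : ℕ} (hs : 2 * s + 2 ≤ S.N) :
    sandwich (S.QGt (2 * s)) (S.HSub z) -
        toP (S.QGt (2 * s) * S.W * S.resummed z s * S.Wstar * S.QGt (2 * s)) =
      S.flowHamiltonian z (s + 1) := by
  have hp := S.isDiag_below (2 * (s + 1))
  have hD := (hp.mul (isDiag_W_mul_resummed_mul_Wstar (hX.isDiag_dressed hs))).mul hp
  rw [belowInd_mul_gam, mul_comm (S.gam z (s + 1)), belowInd_mul_gam, ← mul_assoc,
    ← mul_assoc] at hD
  have hQGt : S.QGt (2 * s) = S.below (2 * (s + 1)) := S.QGt_eq_below _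
  rw [HSub_eq, hQGt, sandwich_perturbedMul hp (S.belowInd_mul_self _), perturbedMul_sub_toP]
  exact hD.perturbedMul_sub

theorem KPrev_eq (s : ℕ) (hs : 2 * s ≤ S.N) : S.KPrev z s = S.flowHamiltonian z s := by
  induction s with
  | zero => exact (S.flowHamiltonian_zero z).symm
  | succ s ih =>
    rw [KPrev, ih (by lia), hX.feshbach_flowHamiltonian hs, hX.sandwich_HSub_sub hs]

theorem K_eq {s : ℕ} (hs : 2 * s + 2 ≤ S.N) :
    S.K z s = sandwich (S.QGt (2 * s)) (S.HSub z) -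
      toP (S.QGt (2 * s) * S.W * S.resummed z s * S.Wstar * S.QGt (2 * s)) := by
  rw [K, hX.KPrev_eq s (by lia), hX.feshbach_flowHamiltonian hs]

theorem blockInvertible_KPrev {s : ℕ} (hs : 2 * s + 2 ≤ S.N) :
    BlockInvertible (S.Q (2 * s)) (S.KPrev z s) :=
  ⟨_, hX.KPrev_eq s (by lia) ▸ hX.isBlockInverse_flow hs⟩

theorem K_domain {s : ℕ} (hs : 2 * s + 2 ≤ S.N) :
    (S.K z s).domain = (sandwich (S.QGt (2 * s)) (S.HSub z)).domain := by
  rw [hX.K_eq hs]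
  exact inf_top_eq _

theorem isSelfAdjoint_K {s : ℕ} (hs : 2 * s + 2 ≤ S.N) : IsSelfAdjoint (S.K z s) := by
  have hp := (S.isDiag_below (2 * (s + 1))).isSelfAdjoint
  have hT : IsSelfAdjoint (S.W + S.Wstar) := S.star_W ▸ IsSelfAdjoint.add_star_self S.W
  rw [hX.K_eq hs, hX.sandwich_HSub_sub hs]
  refine isSelfAdjoint_perturbedMul _ ?_
  simpa only [hp.star_eq] using hT.conjugate (S.below (2 * (s + 1)))

theorem isDiag_GamSym {s : ℕ} (hs : 2 * s + 2 ≤ S.N) :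
    IsDiag (S.GamSym z s) (S.gam z s * S.rho z (2 * s)) := by
  have h := S.isDiag_Rsqrt hX.neg (2 * s)
  have hfun : (fun n => √(S.rho z (2 * s) n)) * S.gam z s * (fun n => √(S.rho z (2 * s) n)) =
      S.gam z s * S.rho z (2 * s) := by
    funext n
    simp only [Pi.mul_apply]
    rw [mul_right_comm, Real.mul_self_sqrt (rho_nonneg hX.neg _ n), mul_comm]
  exact hfun ▸ (h.mul (hX.isDiag_Gam s (by lia))).mul h

theorem summable_Gam_mul_R_pow {s : ℕ} (hs : 2 * s + 2 ≤ S.N) :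
    Summable (fun l : ℕ => (S.Gam z s * S.R z (2 * s)) ^ l) :=
  summable_geometric_of_norm_lt_one <|
    hX.norm_lt_one hs ((hX.isDiag_Gam s (by lia)).mul (S.isDiag_R hX.neg (2 * s)))

theorem summable_GamSym_pow {s : ℕ} (hs : 2 * s + 2 ≤ S.N) :
    Summable (fun l : ℕ => (S.GamSym z s) ^ l) :=
  summable_geometric_of_norm_lt_one (hX.norm_lt_one hs (hX.isDiag_GamSym hs))

theorem isDiag_tsum_GamSym_pow {s : ℕ} (hs : 2 * s + 2 ≤ S.N) :
    IsDiag (∑' l : ℕ, (S.GamSym z s) ^ l) (1 - S.gam z s * S.rho z (2 * s))⁻¹ :=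
  (hX.isDiag_GamSym hs).tsum_pow (hX.norm_lt_one hs (hX.isDiag_GamSym hs))

theorem resummed_eq {s : ℕ} (hs : 2 * s + 2 ≤ S.N) :
    S.resummed z s = S.Rsqrt z (2 * s) * (∑' l : ℕ, (S.GamSym z s) ^ l) * S.Rsqrt z (2 * s) := by
  have h := S.isDiag_Rsqrt hX.neg (2 * s)
  refine ((h.mul (hX.isDiag_tsum_GamSym_pow hs)).mul_eq h (hX.isDiag_dressed hs) ?_).symm
  funext n
  simp only [dressed, Pi.mul_apply]
  rw [mul_right_comm, Real.mul_self_sqrt (rho_nonneg hX.neg _ n)]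

theorem Gam_eq_GamSym {s : ℕ} (hs : 2 * s + 2 ≤ S.N) :
    S.Gam z (s + 1) = S.Wblock (2 * (s + 1)) (2 * s) * S.Rsqrt z (2 * s) *
      (∑' l : ℕ, (S.GamSym z s) ^ l) * S.Rsqrt z (2 * s) * S.Wstarblock (2 * s) (2 * (s + 1)) := by
  rw [Gam_succ, hX.resummed_eq hs]
  simp only [mul_assoc]

theorem norm_GamCheck_le {s : ℕ} (hs : 2 * s + 2 ≤ S.N) : ‖S.GamCheck z s‖ ≤ 1 / X s := by
  have hdiag : IsDiag (S.GamCheck z s) (1 - S.gam z s * S.rho z (2 * s))⁻¹ := by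
    cases s with
    | zero =>
      rw [gam, zero_mul, sub_zero, inv_one]
      exact IsDiag.one
    | succ s => exact hX.isDiag_tsum_GamSym_pow hs
  have hXs := hX.pos s hs
  refine hdiag.norm_le (by positivity) fun n => ?_
  have hle : X s ≤ (1 - S.gam z s * S.rho z (2 * s)) n :=
    le_sub_comm.1 (hX.gam_mul_rho_mem s hs n).2
  rw [Pi.inv_apply, abs_of_nonneg (inv_nonneg.2 (hXs.le.trans hle)), one_div]
  exact inv_anti₀ hXs hle

end FlowBound

end ThreeModes

/-! ## The comparison sequence -/

section Parameters

variable {ε : ℝ}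

theorem chi_one_add_sqrt (hε : ε < 1) : chi (1 + √ε) = 1 := by
  have hlt : √ε < 1 := by rwa [Real.sqrt_lt' one_pos, one_pow]
  have hmem : 1 + √ε ∈ Set.Ico (0 : ℝ) 2 := ⟨by positivity, by linarith⟩
  rw [chi, Set.indicator_of_mem hmem, Pi.one_apply]

/-- The quantity `δ √(ε² + 2ε)` with `δ = 1 + √ε`: the admissible `z` are those with
`φ (1 + ε - shift ε) ≤ -z`, and `b_ε` and `c_ε` are functions of `ε` and `shift ε` only. -/
def shift (ε : ℝ) : ℝ := (1 + √ε) * √(ε ^ 2 + 2 * ε)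

theorem bSeq_eq (hε : ε < 1) : bSeq ε = (1 + ε) * shift ε := by
  rw [bSeq, chi_one_add_sqrt hε, shift]
  ring

theorem one_sub_cSeq (h0 : 0 ≤ ε) (hε : ε < 1) : 1 - cSeq ε = (1 + ε) ^ 2 - shift ε ^ 2 := by
  rw [cSeq, chi_one_add_sqrt hε, shift, mul_pow, Real.sq_sqrt (by positivity)]
  ring

/-- The factor `1 + a_ε - 2 b_ε / M - (1 - c_ε) / M²` of the recursion for `X`, with
`a_ε = 2 ε`. -/
def denom (ε M : ℝ) : ℝ := 1 + 2 * ε - 2 * bSeq ε / M - (1 - cSeq ε) / M ^ 2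

theorem XSeq_succ (ε : ℝ) (N s : ℕ) : XSeq (2 * ε) ε N (s + 1) =
    1 - 1 / (4 * denom ε ((N : ℝ) - 2 * s - 1) * XSeq (2 * ε) ε N s) := rfl

theorem le_denom (hc : 0 ≤ cSeq ε) {M : ℝ} (hM : 0 < M) :
    1 + 2 * ε - (1 + 2 * bSeq ε * M) / M ^ 2 ≤ denom ε M := by
  have hcM : 0 ≤ cSeq ε / M ^ 2 := by positivity
  have hdenom : denom ε M = 1 + 2 * ε - (1 + 2 * bSeq ε * M) / M ^ 2 + cSeq ε / M ^ 2 := by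
    rw [denom]
    field_simp
    ring
  linarith

/-- The discrete Riccati function `y ↦ σ - τ / (y - q)` with `τ = 1 + 2√ε`, `σ = b_ε / τ` and
`q = ε^{1/4}`; `(1 + riccati ε (N - 2 s)) / 2` is a subsolution of the recursion for `X_{2 s}`. -/
def riccati (ε y : ℝ) : ℝ := bSeq ε / (1 + 2 * √ε) - (1 + 2 * √ε) / (y - √√ε)

/-- The error in the lower bound for `X`, the value at `y = 2` of the Riccati subsolution without
its positive part `σ`. -/
def remainder (ε : ℝ) : ℝ := (1 - (1 + 2 * √ε) / (2 - √√ε)) / 2 - 1 / 4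

theorem tendsto_remainder : Tendsto remainder (𝓝[>] 0) (𝓝 0) := by
  have hcont : ContinuousAt remainder 0 :=
    ((continuousAt_const.sub (ContinuousAt.div (by fun_prop) (by fun_prop) (by simp))).div_const
      _).sub continuousAt_const
  have hzero : remainder 0 = 0 := by norm_num [remainder]
  exact (hzero ▸ hcont.tendsto).mono_left nhdsWithin_le_nhds

variable (h0 : 0 < ε) (hε : ε ≤ 1 / 10 ^ 8)

include hε in
theorem sqrt_eps_le : √ε ≤ 1 / 10 ^ 4 := by
  rw [Real.sqrt_le_left (by norm_num)]
  linarith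

include hε in
theorem sqrt_sqrt_eps_le : √√ε ≤ 1 / 100 := by
  rw [Real.sqrt_le_left (by norm_num)]
  linarith [sqrt_eps_le hε]

include h0 hε

theorem shift_bounds : 141 / 100 * √ε ≤ shift ε ∧ shift ε ≤ 142 / 100 * √ε := by
  have hw : 0 < √ε := Real.sqrt_pos.2 h0
  have hw' := sqrt_eps_le hε
  have hroot : √(ε ^ 2 + 2 * ε) = √ε * √(ε + 2) := by
    rw [← Real.sqrt_mul h0.le]
    ring_nf
  have hlo : 141 / 100 ≤ √(ε + 2) := Real.le_sqrt_of_sq_le (by linarith)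
  have hhi : √(ε + 2) ≤ 1415 / 1000 := Real.sqrt_le_iff.2 ⟨by norm_num, by linarith⟩
  rw [shift, hroot, mul_left_comm, mul_comm √ε]
  refine ⟨mul_le_mul_of_nonneg_right ?_ hw.le, mul_le_mul_of_nonneg_right ?_ hw.le⟩ <;> nlinarith

theorem bSeq_bounds : 141 / 100 * √ε ≤ bSeq ε ∧ bSeq ε ≤ 143 / 100 * √ε := by
  obtain ⟨hlo, hhi⟩ := shift_bounds h0 hε
  have hw : 0 < √ε := Real.sqrt_pos.2 h0
  rw [bSeq_eq (by linarith)]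
  constructor <;> nlinarith

theorem bSeq_pos : 0 < bSeq ε := by
  linarith [(bSeq_bounds h0 hε).1, Real.sqrt_pos.2 h0]

theorem one_sub_cSeq_nonneg : 0 ≤ 1 - cSeq ε := by
  obtain ⟨hlo, hhi⟩ := shift_bounds h0 hε
  have hw' := sqrt_eps_le hε
  rw [one_sub_cSeq h0.le (by linarith)]
  nlinarith

theorem cSeq_nonneg : 0 ≤ cSeq ε := by
  have hcSeq : cSeq ε = ((1 + √ε) ^ 2 - 1) * (ε ^ 2 + 2 * ε) := by
    rw [cSeq, chi_one_add_sqrt (by linarith)]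
    ring
  rw [hcSeq]
  exact mul_nonneg (by nlinarith [Real.sqrt_nonneg ε]) (by positivity)

theorem bSeq_sq_le : bSeq ε ^ 2 * (1 + 2 * ε) ≤ 2 * ε * (1 + 2 * √ε) ^ 2 := by
  have hw : 0 < √ε := Real.sqrt_pos.2 h0
  have hw' := sqrt_eps_le hε
  have hε_sq : √ε ^ 2 = ε := Real.sq_sqrt h0.le
  have hb : bSeq ε ^ 2 = (1 + ε) ^ 2 * (1 + √ε) ^ 2 * (ε ^ 2 + 2 * ε) := by
    rw [bSeq_eq (by linarith), shift, mul_pow, mul_pow, Real.sq_sqrt (by positivity)]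
    ring
  have hsmall : (1 + ε) ^ 2 * ((1 + ε / 2) * (1 + 2 * ε)) ≤ 1 + √ε := by
    calc (1 + ε) ^ 2 * ((1 + ε / 2) * (1 + 2 * ε)) ≤ (1 + 3 * ε) * (1 + 3 * ε) := by
          gcongr <;> nlinarith
      _ ≤ 1 + √ε := by nlinarith
  have hcube : (1 + √ε) * (1 + √ε) ^ 2 ≤ (1 + 2 * √ε) ^ 2 := by nlinarith
  calc bSeq ε ^ 2 * (1 + 2 * ε)
      = 2 * ε * (((1 + ε) ^ 2 * ((1 + ε / 2) * (1 + 2 * ε))) * (1 + √ε) ^ 2) := by rw [hb]; ring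
    _ ≤ 2 * ε * ((1 + √ε) * (1 + √ε) ^ 2) := by gcongr
    _ ≤ 2 * ε * (1 + 2 * √ε) ^ 2 := by gcongr

theorem sq_bSeq_div_le : (bSeq ε / (1 + 2 * √ε)) ^ 2 * (1 + 2 * ε) ≤ 2 * ε := by
  rw [div_pow, div_mul_eq_mul_div, div_le_iff₀ (by positivity)]
  exact bSeq_sq_le h0 hε

end Parameters

section Resummation

variable {b q e M : ℝ} (hq0 : 0 < q) (hq : q ≤ 1 / 100) (hb0 : 0 < b) (hM : 3 ≤ M)

include hq0 hq hb0 hM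

theorem resummation_numerator_le (hb : b ≤ 2 * q ^ 2) (he : e ≤ b * q) :
    (1 + 2 * b * M) * ((M - q) ^ 2 - 1) ≤
      (1 - e + 2 * b * (M - q)) * (M ^ 2 - 1 - 2 * b * M) := by
  have hbq : b ≤ q / 50 := by nlinarith
  have hdenom : 0 ≤ M ^ 2 - 1 - 2 * b * M := by nlinarith
  have hqM : 0 ≤ q * M := by positivity
  have hloss : (e + 2 * b * q) * (M ^ 2 - 1 - 2 * b * M) ≤ 3 * b * q * M ^ 2 := by
    calc (e + 2 * b * q) * (M ^ 2 - 1 - 2 * b * M)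
        ≤ (3 * b * q) * (M ^ 2 - 1 - 2 * b * M) := by gcongr; linarith
      _ ≤ 3 * b * q * M ^ 2 := by gcongr; nlinarith
  have hgain : 3 * b * q * M ^ 2 ≤ (1 + 2 * b * M) * (2 * q * M - q ^ 2 - 2 * b * M) := by
    calc 3 * b * q * M ^ 2 ≤ (1 + 2 * b * M) * (3 / 2 * q * M) := by nlinarith
      _ ≤ (1 + 2 * b * M) * (2 * q * M - q ^ 2 - 2 * b * M) := by gcongr; nlinarith
  nlinarith

omit hb0 in
theorem sq_sub_one_pos : 0 < (M - q) ^ 2 - 1 := by nlinarith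

theorem one_le_resummation (hb : b ≤ 2 * q ^ 2) (he : e ≤ b * q) :
    1 ≤ (1 - (1 + 2 * b * M) / M ^ 2) *
      (1 + (1 - e + 2 * b * (M - q)) / ((M - q) ^ 2 - 1)) := by
  have hY := sq_sub_one_pos hq0 hq hM
  have : 0 < M := by linarith
  have hnum := resummation_numerator_le hq0 hq hb0 hM hb he
  have hprod : (1 - (1 + 2 * b * M) / M ^ 2) * (1 + (1 - e + 2 * b * (M - q)) / ((M - q) ^ 2 - 1)) =
      (M ^ 2 - 1 - 2 * b * M) * ((M - q) ^ 2 - 1 + (1 - e + 2 * b * (M - q))) /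
        (M ^ 2 * ((M - q) ^ 2 - 1)) := by
    field_simp
    ring
  rw [hprod, le_div_iff₀ (by positivity)]
  linarith

end Resummation

section Subsolution

variable {ε : ℝ} (h0 : 0 < ε) (hε : ε ≤ 1 / 10 ^ 8)

theorem one_add_riccati_mul_one_sub_riccati {M : ℝ} (h₁ : M + 1 - √√ε ≠ 0)
    (h₂ : M - 1 - √√ε ≠ 0) :
    (1 + riccati ε (M + 1)) * (1 - riccati ε (M - 1)) =
      1 - (bSeq ε / (1 + 2 * √ε)) ^ 2 +
        (1 - (2 * √ε) ^ 2 + 2 * bSeq ε * (M - √√ε)) / ((M - √√ε) ^ 2 - 1) := by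
  have hfactor : (M - √√ε) ^ 2 - 1 = (M + 1 - √√ε) * (M - 1 - √√ε) := by ring
  have hτ : 1 + 2 * √ε ≠ 0 := by positivity
  rw [riccati, riccati, hfactor]
  field_simp
  ring

include h0 hε

theorem remainder_le_riccati {y : ℝ} (hy : 2 ≤ y) :
    1 / 4 + remainder ε ≤ (1 + riccati ε y) / 2 := by
  have hσ : 0 ≤ bSeq ε / (1 + 2 * √ε) := div_nonneg (bSeq_pos h0 hε).le (by positivity)
  have hτ : (1 + 2 * √ε) / (y - √√ε) ≤ (1 + 2 * √ε) / (2 - √√ε) := by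
    have hq := sqrt_sqrt_eps_le hε
    gcongr
    linarith
  rw [remainder, riccati]
  linarith

omit h0 in
theorem remainder_pos : 0 < 1 / 4 + remainder ε := by
  have hw := sqrt_eps_le hε
  have hq := sqrt_sqrt_eps_le hε
  have hτ : (1 + 2 * √ε) / (2 - √√ε) < 1 := by
    rw [div_lt_one (by linarith)]
    linarith
  rw [remainder]
  linarith

theorem riccati_le_one {y : ℝ} (hy : 2 ≤ y) : riccati ε y ≤ 1 := by
  have hq := sqrt_sqrt_eps_le hε
  have hσ : bSeq ε / (1 + 2 * √ε) ≤ 1 := by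
    rw [div_le_one (by positivity)]
    linarith [(bSeq_bounds h0 hε).2, Real.sqrt_nonneg ε]
  have hτ : 0 ≤ (1 + 2 * √ε) / (y - √√ε) := div_nonneg (by positivity) (by linarith)
  rw [riccati]
  linarith

theorem one_le_denom_mul_riccati {M : ℝ} (hM : 3 ≤ M) :
    1 ≤ denom ε M * ((1 + riccati ε (M + 1)) * (1 - riccati ε (M - 1))) := by
  have hq0 : 0 < √√ε := Real.sqrt_pos.2 (Real.sqrt_pos.2 h0)
  have hq := sqrt_sqrt_eps_le hε
  have hq_sq : √√ε ^ 2 = √ε := Real.sq_sqrt (Real.sqrt_nonneg ε)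
  obtain ⟨hb_lo, hb_hi⟩ := bSeq_bounds h0 hε
  have hb0 := bSeq_pos h0 hε
  have hσ := sq_bSeq_div_le h0 hε
  have hY := sq_sub_one_pos hq0 hq hM
  have he : (2 * √ε) ^ 2 ≤ bSeq ε * √√ε := by
    calc (2 * √ε) ^ 2 = (4 * √√ε * √ε) * √√ε := by linear_combination (-4 * √ε) * hq_sq
      _ ≤ bSeq ε * √√ε := by gcongr; nlinarith
  have hP := one_le_resummation hq0 hq hb0 hM (by linarith) he
  have hdenom := le_denom (cSeq_nonneg h0 hε) (by linarith : 0 < M)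
  rw [one_add_riccati_mul_one_sub_riccati (by linarith) (by linarith)]
  set P := (1 + 2 * bSeq ε * M) / M ^ 2
  set P' := (1 - (2 * √ε) ^ 2 + 2 * bSeq ε * (M - √√ε)) / ((M - √√ε) ^ 2 - 1)
  set σ := bSeq ε / (1 + 2 * √ε)
  have hP0 : 0 ≤ P * σ ^ 2 := by positivity
  have hP'0 : 0 ≤ P' := by
    refine div_nonneg ?_ hY.le
    have : 0 ≤ bSeq ε * (M - √√ε) := mul_nonneg hb0.le (by linarith)
    nlinarith [sqrt_eps_le hε, Real.sqrt_nonneg ε]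
  calc 1 ≤ (1 - P) * (1 + P') + (2 * ε - σ ^ 2 * (1 + 2 * ε)) := by linarith
    _ ≤ (1 + 2 * ε - P) * (1 - σ ^ 2 + P') := by nlinarith
    _ ≤ denom ε M * (1 - σ ^ 2 + P') := by
      gcongr
      nlinarith

theorem denom_pos {M : ℝ} (hM : 3 ≤ M) : 0 < denom ε M := by
  have hu := remainder_le_riccati h0 hε (by linarith : 2 ≤ M + 1)
  have hu' := riccati_le_one h0 hε (by linarith : 2 ≤ M - 1)
  have hv : 0 ≤ (1 + riccati ε (M + 1)) * (1 - riccati ε (M - 1)) :=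
    mul_nonneg (by linarith [remainder_pos hε]) (by linarith)
  exact pos_of_mul_pos_left (one_pos.trans_le (one_le_denom_mul_riccati h0 hε hM)) hv

omit h0 hε in
theorem half_one_add_le_one_sub_div {A u v X : ℝ} (hA : 0 < A) (hu : 0 < 1 + u) (hv : v ≤ 1)
    (hX : (1 + u) / 2 ≤ X) (h : 1 ≤ A * ((1 + u) * (1 - v))) :
    (1 + v) / 2 ≤ 1 - 1 / (4 * A * X) := by
  have hX0 : 0 < X := by linarith
  have hmono : A * ((1 + u) * (1 - v)) ≤ A * (2 * X * (1 - v)) := by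
    gcongr; linarith
  have hdiv : 1 / (4 * A * X) ≤ (1 - v) / 2 := by
    rw [div_le_div_iff₀ (by positivity) two_pos]
    linarith
  linarith

theorem riccati_le_XSeq {N s : ℕ} (hs : 2 * s + 2 ≤ N) :
    (1 + riccati ε (N - 2 * s)) / 2 ≤ XSeq (2 * ε) ε N s := by
  induction s with
  | zero =>
    have hN : (2 : ℝ) ≤ N := by exact_mod_cast hs
    simp only [XSeq, Nat.cast_zero, mul_zero, sub_zero]
    linarith [riccati_le_one h0 hε hN]
  | succ s ih =>
    have hN : (2 : ℝ) * s + 4 ≤ N := by exact_mod_cast (by lia : 2 * s + 4 ≤ N)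
    have hM : (3 : ℝ) ≤ N - 2 * s - 1 := by linarith
    have hstep := one_le_denom_mul_riccati h0 hε hM
    rw [sub_add_cancel, show (N : ℝ) - 2 * s - 1 - 1 = N - 2 * (s + 1 : ℕ) by push_cast; ring]
      at hstep
    have hu := remainder_le_riccati h0 hε (by linarith : (2 : ℝ) ≤ N - 2 * s)
    exact half_one_add_le_one_sub_div (denom_pos h0 hε hM) (by linarith [remainder_pos hε])
      (riccati_le_one h0 hε (by push_cast; linarith)) (ih (by lia)) hstep

theorem remainder_le_XSeq {N s : ℕ} (hs : 2 * s + 2 ≤ N) :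
    1 / 4 + remainder ε ≤ XSeq (2 * ε) ε N s := by
  have hN : (2 : ℝ) * s + 2 ≤ N := by exact_mod_cast hs
  exact (remainder_le_riccati h0 hε (by linarith)).trans (riccati_le_XSeq h0 hε hs)

theorem XSeq_pos {N s : ℕ} (hs : 2 * s + 2 ≤ N) : 0 < XSeq (2 * ε) ε N s :=
  (remainder_pos hε).trans_le (remainder_le_XSeq h0 hε hs)

end Subsolution

/-! ## Neighbouring sectors -/

theorem add_mul_le_mul_of_two_le {x m D e₁ : ℝ} (hx : 2 ≤ x) (hm : 1 ≤ m) (hmD : m ≤ D)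
    (hD : 2 ≤ D) (h₁ : 99 / 100 ≤ e₁) :
    x * (m + e₁) + D * e₁ ≤ 404 / 100 * (D * e₁ * (x - 1)) := by
  have hm_le : 2 * m ≤ 203 / 100 * (D * e₁) := by nlinarith
  have he_le : 2 * e₁ ≤ D * e₁ := by nlinarith
  calc x * (m + e₁) + D * e₁
      ≤ (x - 1) * (2 * m + 2 * e₁) + (x - 1) * (D * e₁) := by nlinarith
    _ ≤ (x - 1) * (203 / 100 * (D * e₁) + D * e₁) + (x - 1) * (D * e₁) := by
      gcongr
      linarith
    _ ≤ 404 / 100 * (D * e₁ * (x - 1)) := by nlinarith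

theorem sector_product_le {x m D : ℕ} {e₁ e₂ : ℝ} (hx : 2 ≤ x) (hm : 1 ≤ m) (hmD : m ≤ D)
    (hxD : 4 ≤ x + D) (h₁ : 99 / 100 ≤ e₁) (h₂ : 99 / 100 ≤ e₂) :
    (x : ℝ) * (x - 1) * ((m + e₁) * (m + 2 + e₂)) ≤
      (x * m + (x + D) * e₁) * ((x - 2) * (m + 2) + (x + D) * e₂) := by
  have hx' : (2 : ℝ) ≤ x := by exact_mod_cast hx
  have hm' : (1 : ℝ) ≤ m := by exact_mod_cast hm
  have hmD' : (m : ℝ) ≤ D := by exact_mod_cast hmD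
  -- The second factor on the right is `(x - 1) (m + 2 + e₂)` minus this loss.
  set ℓ : ℝ := m + 2 - (D + 1) * e₂ with hℓ
  obtain ⟨C, hsum, hloss⟩ : ∃ C : ℝ,
      x * (m + e₁) + D * e₁ ≤ C * (D * e₁ * (x - 1)) ∧ ℓ * C ≤ m + 2 + e₂ := by
    rcases (by lia : 2 ≤ D ∨ m = 1 ∧ D = 1 ∧ 3 ≤ x) with hD | ⟨rfl, rfl, hx3⟩
    · have hD' : (2 : ℝ) ≤ D := by exact_mod_cast hD
      exact ⟨404 / 100, add_mul_le_mul_of_two_le hx' hm' hmD' hD' h₁, by nlinarith⟩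
    · have hx3' : (3 : ℝ) ≤ x := by exact_mod_cast hx3
      refine ⟨353 / 100, ?_, ?_⟩ <;> push_cast [hℓ] <;> nlinarith
  have hsum0 : 0 ≤ x * (m + e₁) + D * e₁ := by positivity
  have hT : 0 ≤ D * e₁ * ((x : ℝ) - 1) := mul_nonneg (by positivity) (by linarith)
  have hgain : ℓ * (x * (m + e₁) + D * e₁) ≤ D * e₁ * ((x - 1) * (m + 2 + e₂)) := by
    rcases le_total ℓ 0 with hneg | hpos
    · refine (mul_nonpos_of_nonpos_of_nonneg hneg hsum0).trans ?_
      rw [← mul_assoc]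
      exact mul_nonneg hT (by positivity)
    · calc ℓ * (x * (m + e₁) + D * e₁) ≤ ℓ * (C * (D * e₁ * (x - 1))) := by gcongr
        _ = (ℓ * C) * (D * e₁ * (x - 1)) := by ring
        _ ≤ (m + 2 + e₂) * (D * e₁ * (x - 1)) := by gcongr
        _ = D * e₁ * ((x - 1) * (m + 2 + e₂)) := by ring
  rw [hℓ] at hgain
  linarith

section Parameters

variable {ε : ℝ} (h0 : 0 < ε) (hε : ε ≤ 1 / 10 ^ 8)

include h0 hε

theorem le_one_add_sub_shift : 99 / 100 ≤ 1 + ε - shift ε := by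
  linarith [(shift_bounds h0 hε).2, sqrt_eps_le hε]

theorem sq_mul_denom_le {m M : ℝ} (hm : 0 ≤ m) (hM : 0 < M) (hMm : M ≤ m + 2) :
    (m + 2) ^ 2 * denom ε M ≤ (m + (ε * m + (1 + ε - shift ε))) *
      (m + 2 + (ε * (m + 2) + (1 + ε - shift ε))) := by
  have hb := bSeq_pos h0 hε
  have hc := one_sub_cSeq_nonneg h0 hε
  have hdenom : denom ε M ≤ (1 + ε) ^ 2 - 2 * bSeq ε / (m + 2) - (1 - cSeq ε) / (m + 2) ^ 2 := by
    have hb_le : 2 * bSeq ε / (m + 2) ≤ 2 * bSeq ε / M := by gcongr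
    have hc_le : (1 - cSeq ε) / (m + 2) ^ 2 ≤ (1 - cSeq ε) / M ^ 2 := by gcongr
    rw [denom]
    nlinarith
  calc (m + 2) ^ 2 * denom ε M
      ≤ (m + 2) ^ 2 *
          ((1 + ε) ^ 2 - 2 * bSeq ε / (m + 2) - (1 - cSeq ε) / (m + 2) ^ 2) := by gcongr
    _ = (m + 2) ^ 2 * (1 + ε) ^ 2 - 2 * bSeq ε * (m + 2) - (1 - cSeq ε) := by field_simp
    _ = _ := by
      rw [bSeq_eq (by linarith), one_sub_cSeq h0.le (by linarith)]
      ring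

end Parameters

namespace ThreeModes

variable {d : ℕ} (S : ThreeModes d)

theorem eps_pos : 0 < S.eps := by
  refine div_pos ?_ S.phi_pos
  obtain ⟨r, hr⟩ := Function.ne_iff.1 S.j_ne_zero
  refine Finset.sum_pos' (fun _ _ => sq_nonneg _) ⟨r, Finset.mem_univ r, sq_pos_of_ne_zero ?_⟩
  have hjr : (S.j r : ℝ) ≠ 0 := by exact_mod_cast hr
  have hL := S.L_pos
  positivity

theorem ksq_eq : S.ksq S.j = S.phi * S.eps := by
  rw [eps, mul_div_cancel₀ _ S.phi_pos.ne']

theorem EBog_add_eq : S.EBog + √S.eps * S.phi * √(S.eps ^ 2 + 2 * S.eps) =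
    -(S.phi * (1 + S.eps - shift S.eps)) := by
  have hfactor : (S.phi * S.eps) ^ 2 + 2 * S.phi * (S.phi * S.eps) =
      S.phi ^ 2 * (S.eps ^ 2 + 2 * S.eps) := by ring
  rw [EBog, ksq_eq, hfactor, Real.sqrt_mul (sq_nonneg _), Real.sqrt_sq S.phi_pos.le, shift]
  ring

/-- In units of `φ / N`, a lower bound for `H - z` on the configurations with `x` particles in the
mode `0` and `m` particles in the modes `±j`, for every admissible `z`. -/
def gap (x m : ℝ) : ℝ := x * m + S.N * (S.eps * m + (1 + S.eps - shift S.eps))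

variable {S} (hε : S.eps ≤ 1 / 10 ^ 8)

include hε in
theorem gap_pos (hN : 0 < S.N) {x m : ℝ} (hx : 0 ≤ x) (hm : 0 ≤ m) : 0 < S.gap x m := by
  have h0 := S.eps_pos
  have hζ : 0 < 1 + S.eps - shift S.eps := by linarith [le_one_add_sub_shift h0 hε]
  rw [gap]
  positivity

include hε in
theorem mul_denom_le_gap_mul_gap {x m : ℕ} {M : ℝ} (hx : 2 ≤ x) (hm : 1 ≤ m)
    (hxm : x + m ≤ S.N) (hN : 4 ≤ S.N) (hM : 0 < M) (hMm : M ≤ m + 2) :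
    (x : ℝ) * (x - 1) * ((m + 2) ^ 2 * denom S.eps M) ≤
      S.gap x m * S.gap (x - 2) (m + 2) := by
  have h0 := S.eps_pos
  have hζ := le_one_add_sub_shift h0 hε
  have hx' : (2 : ℝ) ≤ x := by exact_mod_cast hx
  obtain ⟨D, hD⟩ := Nat.exists_eq_add_of_le (by lia : x ≤ S.N)
  have hxx : (0 : ℝ) ≤ x * (x - 1) := mul_nonneg (by linarith) (by linarith)
  refine (mul_le_mul_of_nonneg_left (sq_mul_denom_le h0 hε (Nat.cast_nonneg m) hM hMm) hxx).trans ?_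
  rw [gap, gap, hD, Nat.cast_add]
  exact sector_product_le hx hm (by lia) (by lia)
    (le_add_of_nonneg_of_le (by positivity) hζ) (le_add_of_nonneg_of_le (by positivity) hζ)

theorem gap_le_energySub {z : ℝ} (hz : z ≤ -(S.phi * (1 + S.eps - shift S.eps))) (hN : 0 < S.N)
    (n : Config d S.N) :
    S.phi / S.N * S.gap (n.1 0) (S.pairCount n) ≤ S.energySub z n := by
  have henergy := le_energy n
  have hN' : (S.N : ℝ) ≠ 0 := by exact_mod_cast hN.ne'
  have hgap : S.phi / S.N * S.gap (n.1 0) (S.pairCount n) =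
      (S.phi * S.eps + S.phi / S.N * n.1 0) * S.pairCount n +
        S.phi * (1 + S.eps - shift S.eps) := by
    rw [gap]
    field_simp
    ring
  rw [ksq_eq] at henergy
  rw [energySub, hgap]
  linarith

include hε in
theorem neg_of_le {z : ℝ} (hz : z ≤ -(S.phi * (1 + S.eps - shift S.eps))) : z < 0 := by
  have hζ : 0 < 1 + S.eps - shift S.eps := by linarith [le_one_add_sub_shift S.eps_pos hε]
  exact hz.trans_lt (neg_neg_of_pos (mul_pos S.phi_pos hζ))

include hε in
theorem rho_le_inv_gap {z : ℝ} (hz : z ≤ -(S.phi * (1 + S.eps - shift S.eps))) (hN : 0 < S.N)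
    (i : ℕ) (n : Config d S.N) :
    S.rho z i n ≤ (S.phi / S.N * S.gap (n.1 0) (S.pairCount n))⁻¹ := by
  have hφ := S.phi_pos
  have hgap := gap_pos hε hN (Nat.cast_nonneg (n.1 0)) (Nat.cast_nonneg (S.pairCount n))
  exact (rho_le_inv (neg_of_le hε hz) i n).trans
    (inv_anti₀ (by positivity) (gap_le_energySub hz hN n))

theorem coefW_sq_le (n : Config d S.N) : S.coefW n ^ 2 ≤
    (S.phi / S.N) ^ 2 * (n.1 0 * (n.1 0 - 1) * ((S.pairCount n + 2) ^ 2 / 4)) := by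
  have hxx : (0 : ℝ) ≤ n.1 0 * (n.1 0 - 1) := by
    rcases Nat.eq_zero_or_pos (n.1 0) with hx | hx
    · rw [hx, Nat.cast_zero, zero_mul]
    · exact mul_nonneg (Nat.cast_nonneg _) (sub_nonneg.2 (by exact_mod_cast hx))
  rw [coefW_sq, mul_assoc ((n.1 0 : ℝ) * _), pairCount, Nat.cast_add]
  gcongr
  linarith [sq_nonneg ((n.1 S.j : ℝ) - n.1 (-S.j))]

include hε in
theorem coefW_sq_mul_rho_le_div_gap {z : ℝ} (hz : z ≤ -(S.phi * (1 + S.eps - shift S.eps)))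
    (hN : 0 < S.N) (i i' : ℕ) {n : Config d S.N} (hpair : zeroPair d ≤ n.1) :
    S.coefW n ^ 2 * S.rho z i (S.up n) * S.rho z i' n ≤
      n.1 0 * (n.1 0 - 1) * (S.pairCount n + 2) ^ 2 /
        (4 * (S.gap (n.1 0) (S.pairCount n) * S.gap (n.1 0 - 2) (S.pairCount n + 2))) := by
  have hφ := S.phi_pos
  have hx : (2 : ℝ) ≤ n.1 0 := by exact_mod_cast zeroPair_le_iff.1 hpair
  have hup_zero : ((S.up n).1 0 : ℝ) = n.1 0 - 2 := by
    rw [← up_apply_zero hpair, Nat.cast_add, Nat.cast_two, add_sub_cancel_right]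
  have hgap := gap_pos hε hN (by linarith : (0 : ℝ) ≤ n.1 0) (Nat.cast_nonneg (S.pairCount n))
  have hgap_up := gap_pos hε hN (sub_nonneg.2 hx) (by positivity : (0 : ℝ) ≤ S.pairCount n + 2)
  have hρ := rho_le_inv_gap hε hz hN i' n
  have hρ_up := rho_le_inv_gap hε hz hN i (S.up n)
  rw [pairCount_up hpair, hup_zero, Nat.cast_add, Nat.cast_two] at hρ_up
  have hρ0 : 0 ≤ S.rho z i' n := rho_nonneg (neg_of_le hε hz) i' n
  have hρ_up0 : 0 ≤ S.rho z i (S.up n) := rho_nonneg (neg_of_le hε hz) i (S.up n)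
  calc S.coefW n ^ 2 * S.rho z i (S.up n) * S.rho z i' n
      ≤ (S.phi / S.N) ^ 2 * (n.1 0 * (n.1 0 - 1) * ((S.pairCount n + 2) ^ 2 / 4)) *
          (S.phi / S.N * S.gap (n.1 0 - 2) (S.pairCount n + 2))⁻¹ *
          (S.phi / S.N * S.gap (n.1 0) (S.pairCount n))⁻¹ :=
        mul_le_mul (mul_le_mul (coefW_sq_le n) hρ_up hρ_up0 ((sq_nonneg _).trans (coefW_sq_le n)))
          hρ hρ0 (mul_nonneg ((sq_nonneg _).trans (coefW_sq_le n)) (hρ_up0.trans hρ_up))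
    _ = _ := by field_simp

include hε in
theorem coefW_sq_mul_rho_le {z : ℝ} (hz : z ≤ -(S.phi * (1 + S.eps - shift S.eps))) {s : ℕ}
    (hs : 2 * (s + 1) + 2 ≤ S.N) (n : Config d S.N) :
    S.coefW n ^ 2 * S.rho z (2 * s) (S.up n) * S.rho z (2 * (s + 1)) n ≤
      1 / (4 * denom S.eps (S.N - 2 * s - 1)) := by
  have hNs : (2 : ℝ) * s + 4 ≤ S.N := by exact_mod_cast (by lia : 2 * s + 4 ≤ S.N)
  have hN : 0 < S.N := by lia
  have hA := denom_pos S.eps_pos hε (by linarith : (3 : ℝ) ≤ S.N - 2 * s - 1)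
  by_cases hn : S.coefW n = 0 ∨ S.qInd (2 * (s + 1)) n = 0
  · have hzero : S.coefW n ^ 2 * S.rho z (2 * s) (S.up n) * S.rho z (2 * (s + 1)) n = 0 := by
      rcases hn with hn | hn <;> simp [rho, hn]
    rw [hzero]
    positivity
  rw [not_or, qInd, ite_eq_right_iff, Classical.not_imp] at hn
  obtain ⟨hW, hsector, -⟩ := hn
  have hpair := zeroPair_le_of_coefW_ne_zero hW
  have hx := zeroPair_le_iff.1 hpair
  have hx' : (2 : ℝ) ≤ n.1 0 := by exact_mod_cast hx
  have hMm : (S.N : ℝ) - 2 * s - 1 ≤ S.pairCount n + 2 := by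
    have : (S.N : ℝ) ≤ S.pairCount n + 2 * s + 3 := by exact_mod_cast (by lia)
    linarith
  have hdenom := mul_denom_le_gap_mul_gap hε hx (by lia : 1 ≤ S.pairCount n)
    (zero_add_pairCount_le n) (by lia) (by linarith) hMm
  have hgap := gap_pos hε hN (Nat.cast_nonneg (n.1 0)) (Nat.cast_nonneg (S.pairCount n))
  have hgap_up := gap_pos hε hN (sub_nonneg.2 hx') (by positivity : (0 : ℝ) ≤ S.pairCount n + 2)
  refine (coefW_sq_mul_rho_le_div_gap hε hz hN _ _ hpair).trans ?_
  rw [div_le_div_iff₀ (by positivity) (by positivity)]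
  linarith

include hε in
theorem flowBound_XSeq {z : ℝ} (hz : z ≤ -(S.phi * (1 + S.eps - shift S.eps))) :
    S.FlowBound z (XSeq (2 * S.eps) S.eps S.N) where
  neg := neg_of_le hε hz
  zero := le_rfl
  pos _ hs := XSeq_pos S.eps_pos hε hs
  step s n hs := by
    have hX := XSeq_pos S.eps_pos hε (by lia : 2 * s + 2 ≤ S.N)
    have hlink : (1 - XSeq (2 * S.eps) S.eps S.N (s + 1)) * XSeq (2 * S.eps) S.eps S.N s =
        1 / (4 * denom S.eps (S.N - 2 * s - 1)) := by
      rw [XSeq_succ, sub_sub_cancel, div_mul_eq_mul_div, one_mul,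
        div_mul_cancel_right₀ hX.ne', one_div]
    exact hlink ▸ coefW_sq_mul_rho_le hε hz hs n

end ThreeModes

end Bogoliubov

end

theorem mainTheorem3_general {d : ℕ} (S : Bogoliubov.ThreeModes d) {z : ℝ}
    (hε : S.eps ≤ 1 / 10 ^ 8)
    (hz : z ≤ S.EBog + √S.eps * S.phi * √(S.eps ^ 2 + 2 * S.eps)) :
    z < 0 ∧
    ∀ s : ℕ, 2 * s + 2 ≤ S.N →
      Bogoliubov.BlockInvertible (S.Q (2 * s)) (S.HSub z) ∧
      0 ≤ S.R z (2 * s) ∧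
      Bogoliubov.BlockInvertible (S.Q (2 * s)) (S.KPrev z s) ∧
      (S.K z s).domain = (Bogoliubov.sandwich (S.QGt (2 * s)) (S.HSub z)).domain ∧
      IsSelfAdjoint (S.K z s) ∧
      (s = 0 →
        S.K z 0 = Bogoliubov.sandwich (S.QGt 0) (S.HSub z) -
          Bogoliubov.toP (S.QGt 0 * S.W * S.R z 0 * S.Wstar * S.QGt 0)) ∧
      (1 ≤ s →
        Summable (fun l : ℕ => (S.Gam z s * S.R z (2 * s)) ^ l) ∧
        Summable (fun l : ℕ => (S.GamSym z s) ^ l) ∧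
        S.K z s = Bogoliubov.sandwich (S.QGt (2 * s)) (S.HSub z) -
          Bogoliubov.toP (S.QGt (2 * s) * S.W * S.R z (2 * s) *
            (∑' l : ℕ, (S.Gam z s * S.R z (2 * s)) ^ l) * S.Wstar * S.QGt (2 * s))) ∧
      (2 ≤ s →
        S.Gam z s = S.Wblock (2 * s) (2 * (s - 1)) * S.Rsqrt z (2 * (s - 1)) *
          (∑' l : ℕ, (S.GamSym z (s - 1)) ^ l) *
          S.Rsqrt z (2 * (s - 1)) * S.Wstarblock (2 * (s - 1)) (2 * s)) ∧
      0 < Bogoliubov.XSeq (2 * S.eps) S.eps S.N s ∧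
      ‖S.GamCheck z s‖ ≤ 1 / Bogoliubov.XSeq (2 * S.eps) S.eps S.N s ∧
      1 / 4 + Bogoliubov.remainder S.eps ≤ Bogoliubov.XSeq (2 * S.eps) S.eps S.N s := by
  have hX := Bogoliubov.ThreeModes.flowBound_XSeq hε (S.EBog_add_eq ▸ hz)
  refine ⟨hX.neg, fun s hs => ⟨S.blockInvertible_HSub hX.neg _, S.R_nonneg hX.neg _,
    hX.blockInvertible_KPrev hs, hX.K_domain hs, hX.isSelfAdjoint_K hs, ?_, fun _ =>
    ⟨hX.summable_Gam_mul_R_pow hs, hX.summable_GamSym_pow hs, ?_⟩, ?_, hX.pos s hs,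
    hX.norm_GamCheck_le hs, Bogoliubov.remainder_le_XSeq S.eps_pos hε hs⟩⟩
  · rintro rfl
    simpa only [Bogoliubov.ThreeModes.resummed_zero] using hX.K_eq hs
  · simpa only [Bogoliubov.ThreeModes.resummed, mul_assoc] using hX.K_eq hs
  · intro hs2
    obtain ⟨t, rfl⟩ := Nat.exists_eq_add_of_le' (one_le_two.trans hs2)
    exact hX.Gam_eq_GamSym (by lia)

theorem mainTheorem3 (ν : ℝ) (hν : 11 / 8 < ν) :
    ∃ a : ℝ → ℝ, (fun ε => a ε - 2 * ε) =O[𝓝[>] 0] (fun ε => ε ^ ν) ∧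
    ∃ r : ℝ → ℝ, Tendsto r (𝓝[>] 0) (𝓝 0) ∧
    ∃ ε₀ : ℝ, 0 < ε₀ ∧
      ∀ (d : ℕ) (S : Bogoliubov.ThreeModes d) (z : ℝ),
        S.eps ≤ ε₀ →
        1 / (S.N : ℝ) ≤ S.eps ^ ν →
        z ≤ S.EBog + Real.sqrt S.eps * S.phi * Real.sqrt (S.eps ^ 2 + 2 * S.eps) →
        z < 0 ∧
        ∀ s : ℕ, 2 * s + 2 ≤ S.N →
          -- the resolvents are well defined and nonnegative
          Bogoliubov.BlockInvertible (S.Q (2 * s)) (S.HSub z) ∧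
          0 ≤ S.R z (2 * s) ∧
          -- the Feshbach-Schur step is well defined and yields a self-adjoint operator
          Bogoliubov.BlockInvertible (S.Q (2 * s)) (S.KPrev z s) ∧
          (S.K z s).domain = (Bogoliubov.sandwich (S.QGt (2 * s)) (S.HSub z)).domain ∧
          IsSelfAdjoint (S.K z s) ∧
          -- the formula for the first step
          (s = 0 →
            S.K z 0 = Bogoliubov.sandwich (S.QGt 0) (S.HSub z) -
              Bogoliubov.toP (S.QGt 0 * S.W * S.R z 0 * S.Wstar * S.QGt 0)) ∧
          -- the convergent Neumann expansions and the formula for the later steps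
          (1 ≤ s →
            Summable (fun l : ℕ => (S.Gam z s * S.R z (2 * s)) ^ l) ∧
            Summable (fun l : ℕ => (S.GamSym z s) ^ l) ∧
            S.K z s = Bogoliubov.sandwich (S.QGt (2 * s)) (S.HSub z) -
              Bogoliubov.toP (S.QGt (2 * s) * S.W * S.R z (2 * s) *
                (∑' l : ℕ, (S.Gam z s * S.R z (2 * s)) ^ l) * S.Wstar * S.QGt (2 * s))) ∧
          -- the symmetric form of the effective interactions
          (2 ≤ s →
            S.Gam z s = S.Wblock (2 * s) (2 * (s - 1)) * S.Rsqrt z (2 * (s - 1)) *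
              (∑' l : ℕ, (S.GamSym z (s - 1)) ^ l) *
              S.Rsqrt z (2 * (s - 1)) * S.Wstarblock (2 * (s - 1)) (2 * s)) ∧
          -- the bound through the auxiliary sequence
          0 < Bogoliubov.XSeq (a S.eps) S.eps S.N s ∧
          ‖S.GamCheck z s‖ ≤ 1 / Bogoliubov.XSeq (a S.eps) S.eps S.N s ∧
          1 / 4 + r S.eps ≤ Bogoliubov.XSeq (a S.eps) S.eps S.N s :=
  ⟨fun ε => 2 * ε, by simpa only [sub_self] using isBigO_zero _ _, Bogoliubov.remainder,
    Bogoliubov.tendsto_remainder, 1 / 10 ^ 8, by norm_num,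
    fun _ S _ hε _ hz => mainTheorem3_general S hε hz⟩
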